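/- Let $\mathbb H$ be the Heisenberg group, i.e. $\mathbb R^3$ with the product $(x,y,z)(x',y',z')=(x+x',\,y+y',\,z+z'+xy')$ (equivalently, the group of the matrices $\begin{pmatrix}1&x&-y&z\\0&1&0&y\\0&0&1&0\\0&0&0&1\end{pmatrix}$), with Lebesgue measure $dx\,dy\,dz$ as Haar measure. On $L^2(\mathbb H)$ let $\tau(u,v)f(p)=f(u^{-1}pv)$ be the biregular representation of $\mathbb H\times\mathbb H$, and put $$\Lambda=\{((k_3,k_2,k_1),(m_3,m_2,0)) : k_1,k_2,k_3,m_2,m_3\in\mathbb Z\}\subset\mathbb H\times\mathbb H.$$ For $\lambda\ne0$ let $\pi_\lambda$ be the Schrödinger representation on $L^2(\mathbb R)$, $\pi_\lambda(x,y,z)\varphi(t)=e^{2\pi i\lambda z}e^{-2\pi i\lambda yt}\varphi(t-x)$. The Plancherel transform $\mathbf P$, from $L^2(\mathbb H)$ to the square-integrable measurable fields (with respect to $|\lambda|\,d\lambda$) of Hilbert–Schmidt operators on $L^2(\mathbb R)$, is the continuous extension of the group Fourier transform $f\mapsto\big(\int_{\mathbb H}f(n)\pi_\lambda(n)\,dn\big)_{\lambda}$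 from $L^1(\mathbb H)\cap L^2(\mathbb H)$. For $\mathcal S\subseteq\mathbb R$ let $$\mathbf H_{\mathcal S}=\{f\in L^2(\mathbb H): \mathbf Pf(\lambda)=0\text{ for almost every }\lambda\notin\mathcal S\}.$$ Sets $I,J\subseteq\mathbb R$ are called translation congruent if, after changing them by Lebesgue null sets, there is a bijection $I\to J$ of the form $\lambda\mapsto\lambda+k(\lambda)$ with $k(\lambda)\in\mathbb Z$. A family $(e_i)$ of vectors of a subspace $M$ of a Hilbert space is a Parseval frame for $M$ if $\sum_i|\langle h,e_i\rangle|^2=\|h\|^2$ for all $h\in M$. **Theorem.** Let $\mathcal S\subseteq[-1,1]$ be Lebesgue measurable and translation congruent to $(0,1]$. Then there is a function $f\in\mathbf H_{\mathcal S}$ such that $(\tau(\gamma,\eta)f)_{(\gamma,\eta)\in\Lambda}$ is a Parseval frame for $\mathbf H_{\mathcal S}$ and $$\|f\|^2_{L^2(\mathbb H)}\le\tfrac23 .$$ Moreover, $f$ can be chosen such that $\mathbf Pf(\lambda)=u_\lambda\otimes v_\lambda$ for almost every $\lambda\in\mathcal S$ (where $u\otimes v$ is the operator $w\mapsto\langle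 w,v\rangle u$, with $\langle\cdot,\cdot\rangle$ linear in the first variable), with $u_\lambda,v_\lambda\in L^2(\mathbb R)$ such that, for every nonzero $\lambda\in\mathcal S$ and for each of the two functions $g=|\lambda|^{1/4}u_\lambda$ and $g=|\lambda|^{1/4}\overline{v_\lambda}$, the Gabor system $\{e^{2\pi i\lambda mt}g(t-n): m,n\in\mathbb Z\}$ over $\mathbb Z\times\lambda\mathbb Z$ is a Parseval frame for $L^2(\mathbb R)$. -/

import Mathlib

open MeasureTheory Set Filter Topology
open scoped ENNReal InnerProductSpace

namespace HeisenbergFrames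

/-! ### The Heisenberg group -/

/-- The three-dimensional Heisenberg group, in the coordinates `(x, y, z)` of the matrix
`[[1, x, -y, z], [0, 1, 0, y], [0, 0, 1, 0], [0, 0, 0, 1]]` (see `Heis.toMatrix`). -/
def Heis : Type := ℝ × ℝ × ℝ

namespace Heis

/-- The coordinate `x`. -/
def x (p : Heis) : ℝ := p.1

/-- The coordinate `y`. -/
def y (p : Heis) : ℝ := p.2.1

/-- The coordinate `z`. -/
def z (p : Heis) : ℝ := p.2.2

/-- The element with coordinates `(a, b, c)`. -/
def mk (a b c : ℝ) : Heis := (a, b, c)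

@[simp] theorem x_mk (a b c : ℝ) : (mk a b c).x = a := rfl
@[simp] theorem y_mk (a b c : ℝ) : (mk a b c).y = b := rfl
@[simp] theorem z_mk (a b c : ℝ) : (mk a b c).z = c := rfl

@[ext] theorem ext {p q : Heis} (hx : p.x = q.x) (hy : p.y = q.y) (hz : p.z = q.z) : p = q :=
  Prod.ext hx (Prod.ext hy hz)

/-- The canonical Haar measure is Lebesgue measure in the coordinates `(x, y, z)`. -/
noncomputable instance : MeasureSpace Heis := inferInstanceAs (MeasureSpace (ℝ × ℝ × ℝ))

noncomputable instance : Mul Heis := ⟨fun p q => mk (p.x + q.x) (p.y + q.y) (p.z + q.z + p.x * q.y)⟩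
noncomputable instance : One Heis := ⟨mk 0 0 0⟩
noncomputable instance : Inv Heis := ⟨fun p => mk (-p.x) (-p.y) (-p.z + p.x * p.y)⟩

@[simp] theorem x_mul (p q : Heis) : (p * q).x = p.x + q.x := rfl
@[simp] theorem y_mul (p q : Heis) : (p * q).y = p.y + q.y := rfl
@[simp] theorem z_mul (p q : Heis) : (p * q).z = p.z + q.z + p.x * q.y := rfl
@[simp] theorem x_one : (1 : Heis).x = 0 := rfl
@[simp] theorem y_one : (1 : Heis).y = 0 := rfl
@[simp] theorem z_one : (1 : Heis).z = 0 := rfl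
@[simp] theorem x_inv (p : Heis) : (p⁻¹).x = -p.x := rfl
@[simp] theorem y_inv (p : Heis) : (p⁻¹).y = -p.y := rfl
@[simp] theorem z_inv (p : Heis) : (p⁻¹).z = -p.z + p.x * p.y := rfl

noncomputable instance : Group Heis :=
  Group.ofLeftAxioms
    (fun p q r => by ext <;> simp <;> ring)
    (fun p => by ext <;> simp)
    (fun p => by ext <;> simp)

/-- The realization of the Heisenberg group by `4 × 4` matrices. -/
def toMatrix (p : Heis) : Matrix (Fin 4) (Fin 4) ℝ :=
  !![1, p.x, -p.y, p.z;
     0, 1, 0, p.y;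
     0, 0, 1, 0;
     0, 0, 0, 1]

/-- The group law on coordinates is multiplication of matrices. -/
theorem toMatrix_mul (p q : Heis) : (p * q).toMatrix = p.toMatrix * q.toMatrix := by
  ext i j
  fin_cases i <;> fin_cases j <;> simp [toMatrix, Matrix.mul_apply, Fin.sum_univ_four] <;> ring

theorem toMatrix_injective : Function.Injective toMatrix := by
  intro p q h
  ext
  · simpa [toMatrix] using congrFun (congrFun h 0) 1
  · simpa [toMatrix] using congrFun (congrFun h 1) 3
  · simpa [toMatrix] using congrFun (congrFun h 0) 3

theorem measurable_x : Measurable x := measurable_fst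
theorem measurable_y : Measurable y := measurable_fst.comp measurable_snd
theorem measurable_z : Measurable z := measurable_snd.comp measurable_snd

theorem measurePreserving_mul_left (u : Heis) :
    MeasurePreserving (fun p : Heis => u * p) volume volume := by
  have h : MeasurePreserving
      (fun p : ℝ × ℝ × ℝ => (u.x + p.1, (u.y + p.2.1, u.z + p.2.2 + u.x * p.2.1)))
      (volume.prod (volume.prod volume)) (volume.prod (volume.prod volume)) := by
    refine (measurePreserving_add_left volume u.x).prod
      (MeasurePreserving.skew_product (measurePreserving_add_left volume u.y)
        (g := fun b c => u.z + c + u.x * b) (by fun_prop) (ae_of_all _ fun b => ?_))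
    have e : (fun c : ℝ => u.z + c + u.x * b) = fun c => (u.z + u.x * b) + c := by
      funext c; ring
    rw [e]
    exact (measurePreserving_add_left volume (u.z + u.x * b)).map_eq
  exact h

theorem measurePreserving_mul_right (v : Heis) :
    MeasurePreserving (fun p : Heis => p * v) volume volume := by
  have h : MeasurePreserving
      (fun p : ℝ × ℝ × ℝ => (p.1 + v.x, (p.2.1 + v.y, p.2.2 + v.z + p.1 * v.y)))
      (volume.prod (volume.prod volume)) (volume.prod (volume.prod volume)) := by
    refine MeasurePreserving.skew_product (measurePreserving_add_right volume v.x)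
        (g := fun a (q : ℝ × ℝ) => (q.1 + v.y, q.2 + v.z + a * v.y)) (by fun_prop)
        (ae_of_all _ fun a => ?_)
    have e : (fun q : ℝ × ℝ => (q.1 + v.y, q.2 + v.z + a * v.y)) =
        Prod.map (fun b => b + v.y) (fun c => c + (v.z + a * v.y)) := by
      funext q; simp [Prod.map]; ring
    rw [e]
    exact ((measurePreserving_add_right volume v.y).prod
      (measurePreserving_add_right volume (v.z + a * v.y))).map_eq
  exact h

end Heis

/-! ### The biregular representation and the discrete set `Λ` -/

/-- `L²(ℍ)`. -/
abbrev L2H : Type := Lp ℂ 2 (volume : Measure Heis)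

/-- `L²(ℝ)`. -/
abbrev L2R : Type := Lp ℂ 2 (volume : Measure ℝ)

/-- Left translation, `(L(u) f)(p) = f(u⁻¹ p)`. -/
noncomputable def leftTranslation (u : Heis) (f : L2H) : L2H :=
  Lp.compMeasurePreserving (fun p => u⁻¹ * p) (Heis.measurePreserving_mul_left u⁻¹) f

/-- Right translation, `(R(v) f)(p) = f(p v)`. -/
noncomputable def rightTranslation (v : Heis) (f : L2H) : L2H :=
  Lp.compMeasurePreserving (fun p => p * v) (Heis.measurePreserving_mul_right v) f

/-- The biregular representation `τ(u, v) = L(u) R(v)` of `ℍ × ℍ` on `L²(ℍ)`. -/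
noncomputable def tau (w : Heis × Heis) (f : L2H) : L2H :=
  leftTranslation w.1 (rightTranslation w.2 f)

/-- The set `Λ ⊆ ℍ × ℍ` of the pairs of matrices with parameters
`(x, y, z) = (k₃, k₂, k₁)` and `(x, y, z) = (m₃, m₂, 0)`, all `kᵢ`, `mⱼ` being integers. -/
def Lam : Set (Heis × Heis) :=
  {w | ∃ k₁ k₂ k₃ m₂ m₃ : ℤ, w = (Heis.mk k₃ k₂ k₁, Heis.mk m₃ m₂ 0)}

/-! ### Parseval frames and Gabor systems -/

/-- The family `e` is a Parseval frame for the subspace `M`: it consists of vectors of `M`, and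
`∑ᵢ |⟨h, eᵢ⟩|² = ‖h‖²` for every `h` in `M`. -/
def IsParsevalFrame {E ι : Type*} [NormedAddCommGroup E] [InnerProductSpace ℂ E]
    (M : Submodule ℂ E) (e : ι → E) : Prop :=
  (∀ i, e i ∈ M) ∧ ∀ h ∈ M, HasSum (fun i => ‖⟪e i, h⟫_ℂ‖ ^ 2) (‖h‖ ^ 2)

/-- A phase times a translate of an element of `L²(ℝ)` is again in `L²(ℝ)`. -/
theorem memLp_phase_translate (θ : ℝ → ℝ) (hθ : Measurable θ) (a : ℝ) (g : L2R) :
    MemLp (fun t : ℝ => Complex.exp (θ t * Complex.I) * g (t - a)) 2 volume := by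
  have h : MemLp (fun t : ℝ => g (t - a)) 2 volume :=
    (Lp.memLp g).comp_measurePreserving (measurePreserving_sub_right volume a)
  refine h.of_le (AEStronglyMeasurable.mul ?_ h.1) (ae_of_all _ fun t => ?_)
  · exact (by fun_prop : Measurable fun t : ℝ =>
      Complex.exp (θ t * Complex.I)).aestronglyMeasurable
  · rw [norm_mul, Complex.norm_exp_ofReal_mul_I, one_mul]

/-- The element `t ↦ e^{i θ(t)} g(t - a)` of `L²(ℝ)`. -/
noncomputable def phaseTranslate (θ : ℝ → ℝ) (hθ : Measurable θ) (a : ℝ) (g : L2R) : L2R :=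
  (memLp_phase_translate θ hθ a g).toLp _

/-- The Gabor system of `g` over `aℤ × bℤ`, that is, the family of the functions
`t ↦ e^{2πi (b m) t} g(t - a n)`, with `m`, `n` integers. -/
noncomputable def gaborSystem (a b : ℝ) (g : L2R) (mn : ℤ × ℤ) : L2R :=
  phaseTranslate (fun t => 2 * Real.pi * (b * mn.1) * t) (by fun_prop) (a * mn.2) g

/-! ### The Plancherel transform -/

/-- The Schrödinger representation `π_λ` on `L²(ℝ)`,
`(π_λ(x, y, z) φ)(t) = e^{2πiλz} e^{-2πiλyt} φ(t - x)`. -/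
noncomputable def schrodinger (l : ℝ) (n : Heis) (φ : L2R) : L2R :=
  phaseTranslate (fun t => 2 * Real.pi * l * n.z - 2 * Real.pi * l * n.y * t)
    (by fun_prop) n.x φ

/-- The bounded operator `T` is the group Fourier transform at `λ` of the function `f` on `ℍ`,
`T = ∫ f(n) π_λ(n) dn` as a weak integral. -/
def IsGroupFourier (f : Heis → ℂ) (l : ℝ) (T : L2R →L[ℂ] L2R) : Prop :=
  ∀ φ ψ : L2R, ⟪ψ, T φ⟫_ℂ = ∫ n : Heis, f n * ⟪ψ, schrodinger l n φ⟫_ℂ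

/-- The Plancherel measure `|λ| dλ`. -/
noncomputable def plancherelMeasure : Measure ℝ :=
  (volume : Measure ℝ).withDensity fun l => ‖l‖ₑ

/-- An orthonormal (Hilbert) basis of `L²(ℝ)`, as a set of vectors. -/
noncomputable def onbL2R : Set L2R := (exists_hilbertBasis ℂ L2R).choose

/-- The square `∑ₖ ‖T eₖ‖²` of the Hilbert–Schmidt norm of a bounded operator on `L²(ℝ)`; it
does not depend on the orthonormal basis, and is `∞` if `T` is not Hilbert–Schmidt. -/
noncomputable def hsNormSq (T : L2R →L[ℂ] L2R) : ℝ≥0∞ := ∑' e : onbL2R, ‖T (e : L2R)‖ₑ ^ 2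

/-- Square-integrable measurable fields of Hilbert–Schmidt operators, that is, the elements of
the direct integral of `L²(ℝ) ⊗ L²(ℝ)` with respect to `|λ| dλ`. -/
structure IsL2Field (T : ℝ → L2R →L[ℂ] L2R) : Prop where
  aemeasurable : ∀ φ ψ : L2R, AEMeasurable (fun l => ⟪ψ, T l φ⟫_ℂ) volume
  lintegral_lt_top : ∫⁻ l, hsNormSq (T l) ∂plancherelMeasure < ∞

/-- The field `T` is (a representative of) the Plancherel transform `P f` of `f ∈ L²(ℍ)`: it is
the limit in the direct integral of the group Fourier transforms of functions in
`L¹(ℍ) ∩ L²(ℍ)` that converge to `f` in `L²(ℍ)`. -/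
def IsPlancherelTransform (f : L2H) (T : ℝ → L2R →L[ℂ] L2R) : Prop :=
  IsL2Field T ∧
  ∃ (g : ℕ → L2H) (G : ℕ → ℝ → L2R →L[ℂ] L2R),
    (∀ k, Integrable (g k) volume) ∧
    (∀ k, ∀ l, l ≠ 0 → IsGroupFourier (g k) l (G k l)) ∧
    (∀ k, IsL2Field (G k)) ∧
    Tendsto g atTop (𝓝 f) ∧
    Tendsto (fun k => ∫⁻ l, hsNormSq (G k l - T l) ∂plancherelMeasure) atTop (𝓝 0)

/-! ### Facts needed to see that band-limited functions form a subspace -/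

theorem norm_phaseTranslate (θ : ℝ → ℝ) (hθ : Measurable θ) (a : ℝ) (g : L2R) :
    ‖phaseTranslate θ hθ a g‖ = ‖g‖ := by
  rw [phaseTranslate, Lp.norm_toLp, Lp.norm_def]
  congr 1
  have h := eLpNorm_comp_measurePreserving (p := 2) (Lp.aestronglyMeasurable g)
    (measurePreserving_sub_right volume a)
  rw [← h]
  refine eLpNorm_congr_norm_ae (ae_of_all _ fun t => ?_)
  rw [norm_mul, Complex.norm_exp_ofReal_mul_I, one_mul]
  rfl

theorem aestronglyMeasurable_inner_schrodinger (l : ℝ) (φ ψ : L2R) :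
    AEStronglyMeasurable (fun n : Heis => ⟪ψ, schrodinger l n φ⟫_ℂ) volume := by
  have e : (fun n : Heis => ⟪ψ, schrodinger l n φ⟫_ℂ) = fun n : Heis => ∫ t : ℝ,
      (Complex.exp (((2 * Real.pi * l * n.z - 2 * Real.pi * l * n.y * t : ℝ) : ℂ) * Complex.I) *
        φ (t - n.x)) * star (ψ t) := by
    funext n
    rw [L2.inner_def]
    refine integral_congr_ae ?_
    filter_upwards [(memLp_phase_translate
      (fun t => 2 * Real.pi * l * n.z - 2 * Real.pi * l * n.y * t) (by fun_prop)
      n.x φ).coeFn_toLp] with t ht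
    rw [schrodinger, phaseTranslate, ht, RCLike.inner_apply]
    rfl
  rw [e]
  have hφ := Lp.stronglyMeasurable φ
  have hψ := Lp.stronglyMeasurable ψ
  have hx : Measurable fun q : Heis × ℝ => q.1.x := Heis.measurable_x.comp measurable_fst
  have hy : Measurable fun q : Heis × ℝ => q.1.y := Heis.measurable_y.comp measurable_fst
  have hz : Measurable fun q : Heis × ℝ => q.1.z := Heis.measurable_z.comp measurable_fst
  have h1 : Measurable fun q : Heis × ℝ => φ (q.2 - q.1.x) :=
    hφ.measurable.comp (measurable_snd.sub hx)
  have h2 : Measurable fun q : Heis × ℝ => star (ψ q.2) :=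
    (continuous_star.measurable).comp (hψ.measurable.comp measurable_snd)
  have h3 : Measurable fun q : Heis × ℝ => Complex.exp
      (((2 * Real.pi * l * q.1.z - 2 * Real.pi * l * q.1.y * q.2 : ℝ) : ℂ) * Complex.I) := by
    fun_prop
  exact (((h3.mul h1).mul h2).stronglyMeasurable.integral_prod_right').aestronglyMeasurable

theorem integrable_mul_inner_schrodinger {f : Heis → ℂ} (hf : Integrable f volume)
    (l : ℝ) (φ ψ : L2R) :
    Integrable (fun n : Heis => f n * ⟪ψ, schrodinger l n φ⟫_ℂ) volume := by
  refine hf.mul_bdd (c := ‖ψ‖ * ‖φ‖) (aestronglyMeasurable_inner_schrodinger l φ ψ)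
    (ae_of_all _ fun n => ?_)
  refine (norm_inner_le_norm _ _).trans_eq ?_
  rw [schrodinger, norm_phaseTranslate]

theorem isGroupFourier_add {f g : L2H} (hf : Integrable f volume) (hg : Integrable g volume)
    {l : ℝ} {A B : L2R →L[ℂ] L2R} (hA : IsGroupFourier f l A) (hB : IsGroupFourier g l B) :
    IsGroupFourier (f + g : L2H) l (A + B) := by
  intro φ ψ
  rw [add_apply, inner_add_right, hA, hB,
    ← integral_add (integrable_mul_inner_schrodinger hf l φ ψ)
      (integrable_mul_inner_schrodinger hg l φ ψ)]
  refine integral_congr_ae ?_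
  filter_upwards [Lp.coeFn_add f g] with n hn
  rw [hn, Pi.add_apply, add_mul]

theorem isGroupFourier_smul (c : ℂ) {f : L2H} {l : ℝ} {A : L2R →L[ℂ] L2R}
    (hA : IsGroupFourier f l A) : IsGroupFourier (c • f : L2H) l (c • A) := by
  intro φ ψ
  rw [smul_apply, inner_smul_right, hA, ← integral_const_mul]
  refine integral_congr_ae ?_
  filter_upwards [Lp.coeFn_smul c f] with n hn
  rw [hn, Pi.smul_apply, smul_eq_mul, mul_assoc]

theorem hsNormSq_zero : hsNormSq 0 = 0 := by simp [hsNormSq]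

theorem hsNormSq_smul (c : ℂ) (A : L2R →L[ℂ] L2R) :
    hsNormSq (c • A) = ‖c‖ₑ ^ 2 * hsNormSq A := by
  simp only [hsNormSq, smul_apply, enorm_smul, mul_pow, ENNReal.tsum_mul_left]

theorem hsNormSq_add_le (A B : L2R →L[ℂ] L2R) :
    hsNormSq (A + B) ≤ 2 * (hsNormSq A + hsNormSq B) := by
  simp only [hsNormSq]
  rw [← ENNReal.tsum_add, ← ENNReal.tsum_mul_left]
  refine ENNReal.tsum_le_tsum fun e => ?_
  rw [add_apply]
  refine (pow_le_pow_left' (enorm_add_le _ _) 2).trans ?_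
  have h := ENNReal.rpow_add_le_mul_rpow_add_rpow ‖A (e : L2R)‖ₑ ‖B (e : L2R)‖ₑ
    (p := 2) (by norm_num)
  norm_num at h
  exact h

theorem countable_onbL2R : onbL2R.Countable := by
  have h := (exists_hilbertBasis ℂ L2R).choose_spec
  obtain ⟨b, hb⟩ := h
  have ho : Orthonormal ℂ ((↑) : onbL2R → L2R) := by
    have := b.orthonormal
    rwa [hb] at this
  have hd : onbL2R.PairwiseDisjoint fun e => Metric.ball e (1 / 2) := by
    intro e he e' he' hne
    refine Metric.ball_disjoint_ball ?_
    have h0 : ⟪e, e'⟫_ℂ = 0 :=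
      ho.2 (i := ⟨e, he⟩) (j := ⟨e', he'⟩) (fun h => hne (congrArg Subtype.val h))
    have h1 : ‖e‖ = 1 := ho.1 ⟨e, he⟩
    have h2 : ‖e'‖ = 1 := ho.1 ⟨e', he'⟩
    have h3 := norm_sub_sq (𝕜 := ℂ) e e'
    rw [h0, h1, h2, map_zero] at h3
    rw [dist_eq_norm]
    nlinarith [norm_nonneg (e - e')]
  have : Fact ((2 : ℝ≥0∞) ≠ ∞) := ⟨by simp⟩
  exact hd.countable_of_isOpen (fun _ _ => Metric.isOpen_ball)
    (fun e _ => ⟨e, Metric.mem_ball_self (by norm_num)⟩)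

theorem enorm_sq_eq_tsum (x : L2R) : ‖x‖ₑ ^ 2 = ∑' e : onbL2R, ‖⟪(e : L2R), x⟫_ℂ‖ₑ ^ 2 := by
  obtain ⟨b, hb⟩ := (exists_hilbertBasis ℂ L2R).choose_spec
  have h : HasSum (fun e : onbL2R => ‖⟪(e : L2R), x⟫_ℂ‖ ^ 2) (‖x‖ ^ 2) := by
    have h1 := b.hasSum_inner_mul_inner x x
    have h2 := (Complex.hasSum_re h1)
    have e1 : ∀ i, (⟪x, b i⟫_ℂ * ⟪b i, x⟫_ℂ).re = ‖⟪((i : onbL2R) : L2R), x⟫_ℂ‖ ^ 2 := by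
      intro i
      rw [show b i = (i : L2R) from congrFun hb i]
      have := inner_mul_symm_re_eq_norm (𝕜 := ℂ) x (i : L2R)
      rw [norm_mul, norm_inner_symm x (i : L2R)] at this
      rw [sq]
      exact this
    have e2 : (⟪x, x⟫_ℂ).re = ‖x‖ ^ 2 := inner_self_eq_norm_sq (𝕜 := ℂ) x
    rw [e2] at h2
    exact (funext e1 : _ = _) ▸ h2
  have key : ∀ r : ℝ, 0 ≤ r → ENNReal.ofReal (r ^ 2) = (ENNReal.ofReal r) ^ 2 := fun r hr =>
    ENNReal.ofReal_pow hr 2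
  rw [← ofReal_norm, ← key _ (norm_nonneg _), ← h.tsum_eq,
    ENNReal.ofReal_tsum_of_nonneg (fun _ => by positivity) h.summable]
  refine tsum_congr fun e => ?_
  rw [key _ (norm_nonneg _), ofReal_norm]

theorem aemeasurable_hsNormSq {T : ℝ → L2R →L[ℂ] L2R}
    (hT : ∀ φ ψ : L2R, AEMeasurable (fun l => ⟪ψ, T l φ⟫_ℂ) volume) :
    AEMeasurable (fun l => hsNormSq (T l)) plancherelMeasure := by
  have : Countable onbL2R := countable_onbL2R.to_subtype
  simp only [hsNormSq, enorm_sq_eq_tsum]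
  refine AEMeasurable.mono_ac ?_ (withDensity_absolutelyContinuous _ _)
  exact AEMeasurable.tsum fun e => AEMeasurable.tsum fun e' =>
    ((hT e e').enorm).pow_const 2

theorem aemeasurable_inner_add {A B : ℝ → L2R →L[ℂ] L2R}
    (hA : ∀ φ ψ : L2R, AEMeasurable (fun l => ⟪ψ, A l φ⟫_ℂ) volume)
    (hB : ∀ φ ψ : L2R, AEMeasurable (fun l => ⟪ψ, B l φ⟫_ℂ) volume) :
    ∀ φ ψ : L2R, AEMeasurable (fun l => ⟪ψ, (A l + B l) φ⟫_ℂ) volume := by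
  intro φ ψ
  simp only [add_apply, inner_add_right]
  exact (hA φ ψ).add (hB φ ψ)

theorem aemeasurable_inner_smul (c : ℂ) {A : ℝ → L2R →L[ℂ] L2R}
    (hA : ∀ φ ψ : L2R, AEMeasurable (fun l => ⟪ψ, A l φ⟫_ℂ) volume) :
    ∀ φ ψ : L2R, AEMeasurable (fun l => ⟪ψ, (c • A l) φ⟫_ℂ) volume := by
  intro φ ψ
  simp only [smul_apply, inner_smul_right]
  exact (hA φ ψ).const_mul c

theorem aemeasurable_inner_sub {A B : ℝ → L2R →L[ℂ] L2R}
    (hA : ∀ φ ψ : L2R, AEMeasurable (fun l => ⟪ψ, A l φ⟫_ℂ) volume)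
    (hB : ∀ φ ψ : L2R, AEMeasurable (fun l => ⟪ψ, B l φ⟫_ℂ) volume) :
    ∀ φ ψ : L2R, AEMeasurable (fun l => ⟪ψ, (A l - B l) φ⟫_ℂ) volume := by
  intro φ ψ
  simp only [sub_apply, inner_sub_right]
  exact (hA φ ψ).sub (hB φ ψ)

theorem lintegral_hsNormSq_add_le {A B : ℝ → L2R →L[ℂ] L2R}
    (hA : ∀ φ ψ : L2R, AEMeasurable (fun l => ⟪ψ, A l φ⟫_ℂ) volume) :
    ∫⁻ l, hsNormSq (A l + B l) ∂plancherelMeasure ≤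
      2 * (∫⁻ l, hsNormSq (A l) ∂plancherelMeasure + ∫⁻ l, hsNormSq (B l) ∂plancherelMeasure) := by
  rw [← lintegral_add_left' (aemeasurable_hsNormSq hA), ← lintegral_const_mul' _ _ (by simp)]
  exact lintegral_mono fun l => hsNormSq_add_le _ _

theorem lintegral_hsNormSq_smul (c : ℂ) (A : ℝ → L2R →L[ℂ] L2R) :
    ∫⁻ l, hsNormSq (c • A l) ∂plancherelMeasure =
      ‖c‖ₑ ^ 2 * ∫⁻ l, hsNormSq (A l) ∂plancherelMeasure := by
  rw [← lintegral_const_mul' _ _ (by finiteness)]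
  simp only [hsNormSq_smul]

theorem IsL2Field.zero : IsL2Field (fun _ => 0) :=
  ⟨fun φ ψ => by simp, by simp [hsNormSq_zero]⟩

theorem IsL2Field.add {A B : ℝ → L2R →L[ℂ] L2R} (hA : IsL2Field A) (hB : IsL2Field B) :
    IsL2Field (fun l => A l + B l) :=
  ⟨aemeasurable_inner_add hA.1 hB.1, (lintegral_hsNormSq_add_le hA.1).trans_lt
    (ENNReal.mul_lt_top (by simp) (ENNReal.add_lt_top.2 ⟨hA.2, hB.2⟩))⟩

theorem IsL2Field.smul (c : ℂ) {A : ℝ → L2R →L[ℂ] L2R} (hA : IsL2Field A) :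
    IsL2Field (fun l => c • A l) :=
  ⟨aemeasurable_inner_smul c hA.1, by
    rw [lintegral_hsNormSq_smul]
    exact ENNReal.mul_lt_top (by finiteness) hA.2⟩

theorem IsPlancherelTransform.zero : IsPlancherelTransform 0 (fun _ => 0) := by
  refine ⟨IsL2Field.zero, fun _ => 0, fun _ _ => 0, fun _ => ?_, fun _ l _ φ ψ => ?_,
    fun _ => IsL2Field.zero, tendsto_const_nhds, ?_⟩
  · exact (integrable_zero _ _ _).congr (Lp.coeFn_zero _ _ _).symm
  · rw [zero_apply, inner_zero_right]
    refine (integral_eq_zero_of_ae ?_).symm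
    filter_upwards [Lp.coeFn_zero ℂ 2 (volume : Measure Heis)] with n hn
    rw [hn]; simp
  · simp [hsNormSq_zero]

theorem IsPlancherelTransform.add {f f' : L2H} {T T' : ℝ → L2R →L[ℂ] L2R}
    (h : IsPlancherelTransform f T) (h' : IsPlancherelTransform f' T') :
    IsPlancherelTransform (f + f') (fun l => T l + T' l) := by
  obtain ⟨hT, g, G, hi, hF, hG, hg, hlim⟩ := h
  obtain ⟨hT', g', G', hi', hF', hG', hg', hlim'⟩ := h'
  refine ⟨hT.add hT', fun k => g k + g' k, fun k l => G k l + G' k l, fun k => ?_,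
    fun k l hl => isGroupFourier_add (hi k) (hi' k) (hF k l hl) (hF' k l hl),
    fun k => (hG k).add (hG' k), hg.add hg', ?_⟩
  · exact ((hi k).add (hi' k)).congr (Lp.coeFn_add _ _).symm
  · have hz : Tendsto (fun k => 2 * (∫⁻ l, hsNormSq (G k l - T l) ∂plancherelMeasure +
        ∫⁻ l, hsNormSq (G' k l - T' l) ∂plancherelMeasure)) atTop (𝓝 0) := by
      simpa using ENNReal.Tendsto.const_mul (a := 2) (hlim.add hlim') (Or.inr (by simp))
    refine tendsto_of_tendsto_of_tendsto_of_le_of_le tendsto_const_nhds hz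
      (fun _ => zero_le) fun k => ?_
    have e : ∀ l, G k l + G' k l - (T l + T' l) = (G k l - T l) + (G' k l - T' l) :=
      fun l => by abel
    simp only [e]
    exact lintegral_hsNormSq_add_le (aemeasurable_inner_sub (hG k).1 hT.1)

theorem IsPlancherelTransform.smul (c : ℂ) {f : L2H} {T : ℝ → L2R →L[ℂ] L2R}
    (h : IsPlancherelTransform f T) : IsPlancherelTransform (c • f) (fun l => c • T l) := by
  obtain ⟨hT, g, G, hi, hF, hG, hg, hlim⟩ := h
  refine ⟨hT.smul c, fun k => c • g k, fun k l => c • G k l, fun k => ?_,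
    fun k l hl => isGroupFourier_smul c (hF k l hl), fun k => (hG k).smul c,
    hg.const_smul c, ?_⟩
  · exact ((hi k).smul c).congr (Lp.coeFn_smul _ _).symm
  · simp only [← smul_sub, lintegral_hsNormSq_smul]
    simpa using ENNReal.Tendsto.const_mul (a := ‖c‖ₑ ^ 2) hlim (Or.inr (by finiteness))

/-! ### Band-limited functions and translation congruence -/

/-- The space `H_S` of the functions in `L²(ℍ)` whose Plancherel transform vanishes almost
everywhere off `S`. -/
def bandlimited (S : Set ℝ) : Submodule ℂ L2H where
  carrier := {f | ∃ T, IsPlancherelTransform f T ∧ ∀ᵐ l, l ∉ S → T l = 0}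
  zero_mem' := ⟨_, IsPlancherelTransform.zero, by simp⟩
  add_mem' := by
    rintro f g ⟨T, hT, h⟩ ⟨T', hT', h'⟩
    refine ⟨_, hT.add hT', ?_⟩
    filter_upwards [h, h'] with l hl hl' hS
    rw [hl hS, hl' hS, add_zero]
  smul_mem' := by
    rintro c f ⟨T, hT, h⟩
    refine ⟨_, hT.smul c, ?_⟩
    filter_upwards [h] with l hl hS
    rw [hl hS, smul_zero]

/-- Translation congruence of subsets of the line: after changing the sets by null sets, there
is a bijection from `I` onto `J` of the form `λ ↦ λ + k(λ)` with `k` integer-valued. -/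
def TranslationCongruent (I J : Set ℝ) : Prop :=
  ∃ I' J' : Set ℝ, I' =ᵐ[volume] I ∧ J' =ᵐ[volume] J ∧
    ∃ k : ℝ → ℤ, BijOn (fun l => l + k l) I' J'

end HeisenbergFrames

open HeisenbergFrames

namespace HeisenbergFrames

/-! ### Square integrals -/

section SquareIntegrals

variable {α E : Type*} [MeasurableSpace α] {μ : Measure α} [NormedAddCommGroup E]

/-! Take `u_λ = v_λ = |λ|^{1/4} 1_{(0,1]}`, so that the prescribed transform on `S` is `|λ|^{1/2}
1_{(0,1]} ⊗ 1_{(0,1]}`. Its squared Hilbert–Schmidt norm is `|λ|`, and the Plancherel density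
contributes another `|λ|`, whence `‖f‖² = ∫_S λ² dλ ≤ ∫_{-1}^{1} λ² dλ = 2/3`.

For `0 < |λ| ≤ 1` the exponentials `e^{2πiλmt}` form a complete orthogonal system on an interval of
length `1/|λ| ≥ 1`. Restricted to each `(n, n+1]` they remain a tight system with bound `1/|λ|`, so
`|λ|^{1/2} 1_{(0,1]}` generates a Parseval Gabor system (`satisfiesParseval_gaborSystem`).

On the Plancherel side `τ(γ, η)` is `A ↦ π_λ(γ) A π_λ(η)⁻¹`, which sends `u ⊗ v` to `π_λ(γ)u ⊗
π_λ(η)v`; the central coordinate `k₁` only contributes the character `e^{2πi k₁ λ}`. If `h` has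
transform `H`, its inner products with the orbit are therefore Fourier coefficients, indexed by
`k₁`, of functions `|λ|^{1/2} ⟨w_k, H(λ) w_m⟩` on `S`, with `w` the Gabor system above
(`inner_tau_eq_integral`). The integer translates of `S` are essentially disjoint, so summing over
`k₁` gives `∫_S |λ| |⟨w_k, H(λ) w_m⟩|² dλ` (`tsum_enorm_fourier_integral_of_disjoint`). Summing over
`k` and `m` gives the squared Hilbert–Schmidt norm of `H(λ)` (`tsum_inner_apply_windowSystem`), and
Plancherel's formula turns the integral into `‖h‖²`.

Plancherel's formula is itself proved here. For integrable `g` the operator at `λ` has kernel `(t,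
s) ↦ ĝ(t - s; λt, λ)`, where the hat is the Fourier transform in `(y, z)`; its Hilbert–Schmidt norm
is the `L²` norm of the kernel, and the substitution `w = λt` absorbs the density `|λ|`
(`lintegral_kernel_change`). The formula passes to limits, and polarization yields the inner
products (`IsPlancherelTransform.inner_eq_integral`). -/

theorem eLpNorm_two_sq (f : α → E) : eLpNorm f 2 μ ^ 2 = ∫⁻ x, ‖f x‖ₑ ^ 2 ∂μ := by
  have h := eLpNorm_nnreal_pow_eq_lintegral (f := f) (μ := μ) (p := 2) (by norm_num)
  norm_num at h
  exact h

theorem enorm_sq_eq_lintegral (f : Lp E 2 μ) : ‖f‖ₑ ^ 2 = ∫⁻ x, ‖f x‖ₑ ^ 2 ∂μ := by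
  rw [← eLpNorm_two_sq, Lp.enorm_def]

theorem memLp_two_iff_lintegral {f : α → E} (hf : AEStronglyMeasurable f μ) :
    MemLp f 2 μ ↔ ∫⁻ x, ‖f x‖ₑ ^ 2 ∂μ < ∞ := by
  rw [← eLpNorm_two_sq]
  constructor
  · intro h
    exact ENNReal.pow_lt_top h.2
  · intro h
    refine ⟨hf, ?_⟩
    by_contra h'
    rw [not_lt, top_le_iff] at h'
    simp [h'] at h

end SquareIntegrals

/-! ### The Fourier transform on `L¹ ∩ L²` -/

section Fourier

open FourierTransform SchwartzMap

variable {E : Type*} [NormedAddCommGroup E] [InnerProductSpace ℝ E] [FiniteDimensional ℝ E]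
  [MeasurableSpace E] [BorelSpace E]

theorem continuous_fourier_of_integrable {f : E → ℂ} (hf : Integrable f) : Continuous (𝓕 f) :=
  VectorFourier.fourierIntegral_continuous Real.continuous_fourierChar
    (by exact continuous_inner) hf

theorem continuous_fourierInv_of_integrable {f : E → ℂ} (hf : Integrable f) :
    Continuous (𝓕⁻ f) := by
  rw [Real.fourierInv_eq_fourier_comp_neg]
  exact continuous_fourier_of_integrable hf.comp_neg

theorem integral_fourier_smul_eq {f g : E → ℂ} (hf : Integrable f) (hg : Integrable g) :
    ∫ w, 𝓕 f w • g w = ∫ x, f x • 𝓕 g x := by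
  have h := VectorFourier.integral_fourierIntegral_smul_eq_flip (L := innerₗ E) (μ := volume)
    (ν := volume) Real.continuous_fourierChar (by exact continuous_inner) hf hg
  rw [flip_innerₗ] at h
  exact h

theorem integral_fourierInv_smul_eq {f g : E → ℂ} (hf : Integrable f) (hg : Integrable g) :
    ∫ w, 𝓕⁻ f w • g w = ∫ x, f x • 𝓕⁻ g x := by
  rw [Real.fourierInv_eq_fourier_comp_neg g, ← integral_fourier_smul_eq hf hg.comp_neg,
    ← integral_neg_eq_self]
  simp [Real.fourierInv_eq_fourier_neg]

/-- Smooth compactly supported functions are Schwartz, so Schwartz tests separate locally integrable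
functions. This compares the `L²` Fourier transform, known through tempered distributions, with the
Fourier integral. -/
theorem ae_eq_of_forall_schwartz {f g : E → ℂ} (hf : LocallyIntegrable f)
    (hg : LocallyIntegrable g) (h : ∀ φ : 𝓢(E, ℂ), ∫ x, φ x • f x = ∫ x, φ x • g x) :
    f =ᵐ[volume] g := by
  refine ae_eq_of_integral_contDiff_smul_eq hf hg fun φ hφ hc => ?_
  have h1 : HasCompactSupport (Complex.ofRealCLM ∘ φ) := hc.comp_left rfl
  have h2 : ContDiff ℝ (⊤ : ℕ∞) (Complex.ofRealCLM ∘ φ) := by fun_prop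
  simpa using h (h1.toSchwartzMap h2)

theorem coeFn_fourier_toLp {f : E → ℂ} (h1 : Integrable f) (h2 : MemLp f 2 volume) :
    ((𝓕 (h2.toLp f) : Lp ℂ 2 (volume : Measure E)) : E → ℂ) =ᵐ[volume] 𝓕 f := by
  refine ae_eq_of_forall_schwartz ((Lp.memLp _).locallyIntegrable (by norm_num))
    (continuous_fourier_of_integrable h1).locallyIntegrable fun φ => ?_
  have h := congrArg (fun T => T φ) (Lp.fourier_toTemperedDistribution_eq (h2.toLp f))
  simp only [TemperedDistribution.fourier_apply, Lp.toTemperedDistribution_apply] at h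
  rw [← h, ← integral_fourier_smul_eq φ.integrable h1]
  refine integral_congr_ae ?_
  filter_upwards [h2.coeFn_toLp] with x hx
  rw [hx, fourier_coe]

theorem coeFn_fourierInv_toLp {f : E → ℂ} (h1 : Integrable f) (h2 : MemLp f 2 volume) :
    ((𝓕⁻ (h2.toLp f) : Lp ℂ 2 (volume : Measure E)) : E → ℂ) =ᵐ[volume] 𝓕⁻ f := by
  refine ae_eq_of_forall_schwartz ((Lp.memLp _).locallyIntegrable (by norm_num))
    (continuous_fourierInv_of_integrable h1).locallyIntegrable fun φ => ?_
  have h := congrArg (fun T => T φ) (Lp.fourierInv_toTemperedDistribution_eq (h2.toLp f))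
  simp only [TemperedDistribution.fourierInv_apply, Lp.toTemperedDistribution_apply] at h
  rw [← h, ← integral_fourierInv_smul_eq φ.integrable h1]
  refine integral_congr_ae ?_
  filter_upwards [h2.coeFn_toLp] with x hx
  rw [hx, fourierInv_coe]

/-- The left side is the norm of `𝓕 (h - 𝓕⁻ m)`, and `𝓕` is an isometry of `L²`. The difference form
matters because `h - 𝓕⁻ m` need not be integrable, so its transform need not be an integral; `m = 0`
and `h = 0` give the two usual Plancherel identities. -/
theorem lintegral_fourier_sub_eq {h m : E → ℂ} (h1 : Integrable h) (h2 : MemLp h 2 volume)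
    (m1 : Integrable m) (m2 : MemLp m 2 volume) :
    ∫⁻ w, ‖𝓕 h w - m w‖ₑ ^ 2 = ∫⁻ x, ‖h x - 𝓕⁻ m x‖ₑ ^ 2 := by
  have e : ‖𝓕 (h2.toLp h) - m2.toLp m‖ₑ ^ 2 = ‖h2.toLp h - 𝓕⁻ (m2.toLp m)‖ₑ ^ 2 := by
    have : 𝓕 (h2.toLp h) - m2.toLp m = 𝓕 (h2.toLp h - 𝓕⁻ (m2.toLp m)) := by
      have := (Lp.fourierTransformₗᵢ E ℂ).map_sub (h2.toLp h) (𝓕⁻ (m2.toLp m))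
      refine (this.trans ?_).symm
      exact congrArg (𝓕 (h2.toLp h) - ·)
        ((Lp.fourierTransformₗᵢ E ℂ).apply_symm_apply (m2.toLp m))
    rw [this, ← ofReal_norm, Lp.norm_fourier_eq, ofReal_norm]
  rw [enorm_sq_eq_lintegral, enorm_sq_eq_lintegral] at e
  convert e using 1
  · refine lintegral_congr_ae ?_
    filter_upwards [Lp.coeFn_sub (𝓕 (h2.toLp h)) (m2.toLp m), coeFn_fourier_toLp h1 h2,
      m2.coeFn_toLp] with x e1 e2 e3
    rw [e1, Pi.sub_apply, e2, e3]
  · refine lintegral_congr_ae ?_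
    filter_upwards [Lp.coeFn_sub (h2.toLp h) (𝓕⁻ (m2.toLp m)), coeFn_fourierInv_toLp m1 m2,
      h2.coeFn_toLp] with x e1 e2 e3
    rw [e1, Pi.sub_apply, e2, e3]

end Fourier

/-! ### The Fourier transform in the plane, with signs as in the Schrödinger representation -/

/-- The partial Fourier transform in the variables `(y, z)`, at `q = (w, l)`. -/
noncomputable def planeFourier (F : ℝ × ℝ → ℂ) (q : ℝ × ℝ) : ℂ :=
  ∫ p : ℝ × ℝ, Complex.exp ((2 * Real.pi * (q.2 * p.2 - q.1 * p.1) : ℝ) * Complex.I) * F p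

/-- The inverse of `planeFourier`. -/
noncomputable def planeFourierInv (m : ℝ × ℝ → ℂ) (p : ℝ × ℝ) : ℂ :=
  ∫ q : ℝ × ℝ, Complex.exp ((2 * Real.pi * (q.1 * p.1 - q.2 * p.2) : ℝ) * Complex.I) * m q

/-- The product `ℝ × ℝ` carries the sup norm, so the Euclidean plane is taken to be `ℂ`. Conjugating
the frequency produces the opposite signs of the phase `λz - wy`. -/
theorem measurePreserving_conj_plane :
    MeasurePreserving (fun w : ℂ => (w.re, -w.im)) volume volume := by
  have h := Complex.volume_preserving_equiv_real_prod.comp Complex.conjLIE.measurePreserving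
  exact h

theorem measurePreserving_plane :
    MeasurePreserving (fun w : ℂ => (w.re, w.im)) volume volume :=
  Complex.volume_preserving_equiv_real_prod

theorem measurableEmbedding_conj_plane : MeasurableEmbedding (fun w : ℂ => (w.re, -w.im)) :=
  Complex.measurableEquivRealProd.measurableEmbedding.comp
    Complex.conjLIE.toHomeomorph.measurableEmbedding

theorem measurableEmbedding_plane : MeasurableEmbedding (fun w : ℂ => (w.re, w.im)) :=
  Complex.measurableEquivRealProd.measurableEmbedding

open FourierTransform in
theorem fourier_comp_plane (F : ℝ × ℝ → ℂ) (w : ℂ) :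
    𝓕 (fun v : ℂ => F (v.re, v.im)) w = planeFourier F (w.re, -w.im) := by
  rw [Real.fourier_eq', planeFourier,
    ← measurePreserving_plane.integral_comp measurableEmbedding_plane]
  refine integral_congr_ae (ae_of_all _ fun v => ?_)
  simp only [smul_eq_mul, Complex.inner]
  congr 4
  simp
  ring

open FourierTransform in
theorem fourierInv_comp_plane (m : ℝ × ℝ → ℂ) (v : ℂ) :
    𝓕⁻ (fun w : ℂ => m (w.re, -w.im)) v = planeFourierInv m (v.re, v.im) := by
  rw [Real.fourierInv_eq', planeFourierInv,
    ← measurePreserving_conj_plane.integral_comp measurableEmbedding_conj_plane]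
  refine integral_congr_ae (ae_of_all _ fun v => ?_)
  simp only [smul_eq_mul, Complex.inner]
  congr 4
  simp
  ring

theorem lintegral_planeFourier_sub_eq {h m : ℝ × ℝ → ℂ} (h1 : Integrable h)
    (h2 : MemLp h 2 volume) (m1 : Integrable m) (m2 : MemLp m 2 volume) :
    ∫⁻ q, ‖planeFourier h q - m q‖ₑ ^ 2 = ∫⁻ p, ‖h p - planeFourierInv m p‖ₑ ^ 2 := by
  have e := lintegral_fourier_sub_eq
    (measurePreserving_plane.integrable_comp_of_integrable h1)
    (h2.comp_measurePreserving measurePreserving_plane)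
    (measurePreserving_conj_plane.integrable_comp_of_integrable m1)
    (m2.comp_measurePreserving measurePreserving_conj_plane)
  simp only [Function.comp_def, fourier_comp_plane, fourierInv_comp_plane] at e
  rw [← measurePreserving_conj_plane.lintegral_comp_emb measurableEmbedding_conj_plane,
    ← measurePreserving_plane.lintegral_comp_emb measurableEmbedding_plane]
  exact e

/-! ### The partial Fourier transform on the Heisenberg group -/

instance : SigmaFinite (volume : Measure Heis) :=
  inferInstanceAs (SigmaFinite (volume : Measure (ℝ × ℝ × ℝ)))

/-- The Fourier transform of `g` in the last two variables. -/
noncomputable def partialFourier (g : Heis → ℂ) (x : ℝ) (q : ℝ × ℝ) : ℂ :=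
  planeFourier (fun p => g (Heis.mk x p.1 p.2)) q

/-- The inverse Fourier transform of `M` in the last two variables. -/
noncomputable def partialFourierInv (M : ℝ → ℝ × ℝ → ℂ) (n : Heis) : ℂ :=
  planeFourierInv (M n.x) (n.y, n.z)

theorem lintegral_heis {φ : Heis → ℝ≥0∞} (hφ : Measurable φ) :
    ∫⁻ n, φ n = ∫⁻ x : ℝ, ∫⁻ p : ℝ × ℝ, φ (Heis.mk x p.1 p.2) :=
  lintegral_prod (μ := (volume : Measure ℝ)) (ν := (volume : Measure (ℝ × ℝ))) _ hφ.aemeasurable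

theorem integral_heis {φ : Heis → ℂ} (hφ : Integrable φ) :
    ∫ n, φ n = ∫ x : ℝ, ∫ p : ℝ × ℝ, φ (Heis.mk x p.1 p.2) :=
  integral_prod (μ := (volume : Measure ℝ)) (ν := (volume : Measure (ℝ × ℝ))) _ hφ

theorem measurable_heis_mk {α : Type*} [MeasurableSpace α] {a b c : α → ℝ} (ha : Measurable a)
    (hb : Measurable b) (hc : Measurable c) : Measurable fun t => Heis.mk (a t) (b t) (c t) :=
  ha.prodMk (hb.prodMk hc)

theorem stronglyMeasurable_partialFourier {g : Heis → ℂ} (hg : Measurable g) :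
    StronglyMeasurable fun r : ℝ × (ℝ × ℝ) => partialFourier g r.1 r.2 := by
  have h1 : Measurable fun s : (ℝ × (ℝ × ℝ)) × (ℝ × ℝ) => g (Heis.mk s.1.1 s.2.1 s.2.2) :=
    hg.comp (measurable_heis_mk (by fun_prop) (by fun_prop) (by fun_prop))
  have h2 : Measurable fun s : (ℝ × (ℝ × ℝ)) × (ℝ × ℝ) => Complex.exp
      ((2 * Real.pi * (s.1.2.2 * s.2.2 - s.1.2.1 * s.2.1) : ℝ) * Complex.I) := by
    fun_prop
  exact (h2.mul h1).stronglyMeasurable.integral_prod_right'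

theorem stronglyMeasurable_partialFourierInv {M : ℝ → ℝ × ℝ → ℂ}
    (hM : Measurable fun r : ℝ × (ℝ × ℝ) => M r.1 r.2) :
    StronglyMeasurable (partialFourierInv M) := by
  have h1 : Measurable fun s : Heis × (ℝ × ℝ) => M s.1.x s.2 :=
    hM.comp ((Heis.measurable_x.comp measurable_fst).prodMk measurable_snd)
  have hy : Measurable fun s : Heis × (ℝ × ℝ) => s.1.y := Heis.measurable_y.comp measurable_fst
  have hz : Measurable fun s : Heis × (ℝ × ℝ) => s.1.z := Heis.measurable_z.comp measurable_fst
  have h2 : Measurable fun s : Heis × (ℝ × ℝ) => Complex.exp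
      ((2 * Real.pi * (s.2.1 * s.1.y - s.2.2 * s.1.z) : ℝ) * Complex.I) := by
    fun_prop
  exact (h2.mul h1).stronglyMeasurable.integral_prod_right'

theorem ae_integrable_slice {g : Heis → ℂ} (hg : Integrable g) :
    ∀ᵐ x : ℝ, Integrable fun p : ℝ × ℝ => g (Heis.mk x p.1 p.2) :=
  Integrable.prod_right_ae (μ := (volume : Measure ℝ)) (ν := (volume : Measure (ℝ × ℝ))) hg

theorem ae_memLp_slice {g : Heis → ℂ} (hm : Measurable g) (hg : ∫⁻ n, ‖g n‖ₑ ^ 2 < ∞) :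
    ∀ᵐ x : ℝ, MemLp (fun p : ℝ × ℝ => g (Heis.mk x p.1 p.2)) 2 volume := by
  have hm2 : Measurable fun n => ‖g n‖ₑ ^ 2 := hm.enorm.pow_const 2
  rw [lintegral_heis hm2] at hg
  have hm3 : Measurable fun x : ℝ => ∫⁻ p : ℝ × ℝ, ‖g (Heis.mk x p.1 p.2)‖ₑ ^ 2 :=
    Measurable.lintegral_prod_right' (f := fun r : ℝ × (ℝ × ℝ) => ‖g r‖ₑ ^ 2) hm2
  filter_upwards [ae_lt_top hm3 hg.ne] with x hx
  refine (memLp_two_iff_lintegral ?_).2 hx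
  exact (hm.comp (measurable_heis_mk measurable_const measurable_fst
    measurable_snd)).aestronglyMeasurable

theorem lintegral_partialFourier_sub {g : Heis → ℂ} (hgm : Measurable g) (hg1 : Integrable g)
    (hg2 : ∫⁻ n, ‖g n‖ₑ ^ 2 < ∞) {M : ℝ → ℝ × ℝ → ℂ}
    (hMm : Measurable fun r : ℝ × (ℝ × ℝ) => M r.1 r.2)
    (hM1 : ∀ x, Integrable (M x)) (hM2 : ∀ x, MemLp (M x) 2 volume) :
    ∫⁻ x : ℝ, ∫⁻ q, ‖partialFourier g x q - M x q‖ₑ ^ 2 =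
      ∫⁻ n, ‖g n - partialFourierInv M n‖ₑ ^ 2 := by
  have hm : Measurable fun n => ‖g n - partialFourierInv M n‖ₑ ^ 2 :=
    (hgm.sub (stronglyMeasurable_partialFourierInv hMm).measurable).enorm.pow_const 2
  rw [lintegral_heis hm]
  refine lintegral_congr_ae ?_
  filter_upwards [ae_integrable_slice hg1, ae_memLp_slice hgm hg2] with x h1 h2
  exact lintegral_planeFourier_sub_eq h1 h2 (hM1 x) (hM2 x)

theorem lintegral_partialFourier {g : Heis → ℂ} (hgm : Measurable g) (hg1 : Integrable g)
    (hg2 : ∫⁻ n, ‖g n‖ₑ ^ 2 < ∞) :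
    ∫⁻ x : ℝ, ∫⁻ q, ‖partialFourier g x q‖ₑ ^ 2 = ∫⁻ n, ‖g n‖ₑ ^ 2 := by
  have h := lintegral_partialFourier_sub hgm hg1 hg2 (M := fun _ _ => 0) measurable_const
    (fun _ => integrable_zero _ _ _) (fun _ => MemLp.zero)
  simpa [partialFourierInv, planeFourierInv] using h

theorem lintegral_partialFourierInv {M : ℝ → ℝ × ℝ → ℂ}
    (hMm : Measurable fun r : ℝ × (ℝ × ℝ) => M r.1 r.2)
    (hM1 : ∀ x, Integrable (M x)) (hM2 : ∀ x, MemLp (M x) 2 volume) :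
    ∫⁻ n, ‖partialFourierInv M n‖ₑ ^ 2 = ∫⁻ x : ℝ, ∫⁻ q, ‖M x q‖ₑ ^ 2 := by
  have h := lintegral_partialFourier_sub (g := fun _ => 0) measurable_const
    (integrable_zero _ _ _) (by simp) hMm hM1 hM2
  simpa [partialFourier, planeFourier] using h.symm

/-! ### Integral kernels and the Hilbert–Schmidt norm -/

/-- The bounded operator `T` on `L²(ℝ)` is the integral operator with kernel `K`. -/
def HasKernel (T : L2R →L[ℂ] L2R) (K : ℝ → ℝ → ℂ) : Prop :=
  ∀ φ : L2R, T φ =ᵐ[volume] fun t => ∫ s, K t s * φ s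

theorem HasKernel.sub {T T' : L2R →L[ℂ] L2R} {K K' : ℝ → ℝ → ℂ} (h : HasKernel T K)
    (h' : HasKernel T' K') (hK : ∀ᵐ t, MemLp (K t) 2 volume)
    (hK' : ∀ᵐ t, MemLp (K' t) 2 volume) :
    HasKernel (T - T') (fun t s => K t s - K' t s) := by
  intro φ
  rw [sub_apply]
  filter_upwards [h φ, h' φ, hK, hK', Lp.coeFn_sub (T φ) (T' φ)] with t h1 h2 h3 h4 h5
  have e := integral_sub (h3.integrable_mul (Lp.memLp φ)) (h4.integrable_mul (Lp.memLp φ))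
  simp only [Pi.mul_apply, ← sub_mul] at e
  rw [h5, Pi.sub_apply, h1, h2, e]

/-- The integrals are inner products of the conjugate of `k` with the basis, so this is Parseval's
identity. -/
theorem enorm_integral_mul_sq_tsum {k : ℝ → ℂ} (hk : MemLp k 2 volume) :
    ∑' e : onbL2R, ‖∫ s, k s * (e : L2R) s‖ₑ ^ 2 = ∫⁻ s, ‖k s‖ₑ ^ 2 := by
  have hx := hk.star
  have h := enorm_sq_eq_tsum (hx.toLp (star k))
  rw [enorm_sq_eq_lintegral] at h
  have e1 : ∫⁻ s, ‖hx.toLp (star k) s‖ₑ ^ 2 = ∫⁻ s, ‖k s‖ₑ ^ 2 := by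
    refine lintegral_congr_ae ?_
    filter_upwards [hx.coeFn_toLp] with s hs
    rw [hs, Pi.star_apply]
    simp [← ofReal_norm]
  rw [← e1, h]
  refine tsum_congr fun e => ?_
  congr 1
  rw [L2.inner_def]
  have : ∫ s, ⟪(e : L2R) s, hx.toLp (star k) s⟫_ℂ = star (∫ s, k s * (e : L2R) s) := by
    rw [Complex.star_def, ← integral_conj]
    refine integral_congr_ae ?_
    filter_upwards [hx.coeFn_toLp] with s hs
    rw [hs, RCLike.inner_apply]
    simp
  rw [this]
  simp [← ofReal_norm]

/-- The sum over the basis moves inside the integral over `t`; Parseval's identity then applies to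
each row `K t`. -/
theorem HasKernel.hsNormSq_eq {T : L2R →L[ℂ] L2R} {K : ℝ → ℝ → ℂ} (h : HasKernel T K)
    (hm : Measurable fun r : ℝ × ℝ => K r.1 r.2) (hK : ∀ᵐ t, MemLp (K t) 2 volume) :
    hsNormSq T = ∫⁻ t, ∫⁻ s, ‖K t s‖ₑ ^ 2 := by
  have : Countable onbL2R := countable_onbL2R.to_subtype
  have e1 : ∀ e : onbL2R, ‖T (e : L2R)‖ₑ ^ 2 = ∫⁻ t, ‖∫ s, K t s * (e : L2R) s‖ₑ ^ 2 := by
    intro e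
    rw [enorm_sq_eq_lintegral]
    refine lintegral_congr_ae ?_
    filter_upwards [h e] with t ht
    rw [ht]
  simp only [hsNormSq, e1]
  rw [← lintegral_tsum]
  · refine lintegral_congr_ae ?_
    filter_upwards [hK] with t ht
    exact enorm_integral_mul_sq_tsum ht
  · intro e
    have he : Measurable fun r : ℝ × ℝ => (e : L2R) r.2 :=
      (Lp.stronglyMeasurable (e : L2R)).measurable.comp measurable_snd
    exact ((hm.mul he).stronglyMeasurable.integral_prod_right'.measurable.enorm.pow_const
      2).aemeasurable

/-! ### The kernel of the group Fourier transform -/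

/-- Cauchy–Schwarz bounds the `t`-integral by `|g n| ‖φ‖ ‖ψ‖`, uniformly in the group element apart
from `g`. This licenses Fubini in `inner_groupFourier`. -/
theorem integrable_groupFourier {g : Heis → ℂ} (hm : Measurable g) (hg : Integrable g) (l : ℝ)
    (φ ψ : L2R) :
    Integrable (fun r : Heis × ℝ => g r.1 * (Complex.exp
      ((2 * Real.pi * l * r.1.z - 2 * Real.pi * l * r.1.y * r.2 : ℝ) * Complex.I) *
        φ (r.2 - r.1.x) * star (ψ r.2))) ((volume : Measure Heis).prod volume) := by
  have hx : Measurable fun q : Heis × ℝ => q.1.x := Heis.measurable_x.comp measurable_fst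
  have hy : Measurable fun q : Heis × ℝ => q.1.y := Heis.measurable_y.comp measurable_fst
  have hz : Measurable fun q : Heis × ℝ => q.1.z := Heis.measurable_z.comp measurable_fst
  have h1 : Measurable fun q : Heis × ℝ => φ (q.2 - q.1.x) :=
    (Lp.stronglyMeasurable φ).measurable.comp (measurable_snd.sub hx)
  have h2 : Measurable fun q : Heis × ℝ => star (ψ q.2) :=
    (continuous_star.measurable).comp ((Lp.stronglyMeasurable ψ).measurable.comp measurable_snd)
  have h3 : Measurable fun q : Heis × ℝ => Complex.exp
      ((2 * Real.pi * l * q.1.z - 2 * Real.pi * l * q.1.y * q.2 : ℝ) * Complex.I) := by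
    fun_prop
  have h4 : Measurable fun q : Heis × ℝ => g q.1 := hm.comp measurable_fst
  have key : ∀ n : Heis, Integrable (fun t => ‖φ (t - n.x)‖ * ‖ψ t‖) ∧
      ∫ t, ‖φ (t - n.x)‖ * ‖ψ t‖ ≤ ‖φ‖ * ‖ψ‖ := by
    intro n
    have a1 : MemLp (fun t => ‖φ (t - n.x)‖) 2 volume :=
      ((Lp.memLp φ).comp_measurePreserving (measurePreserving_sub_right volume n.x)).norm
    have a2 : MemLp (fun t => ‖ψ t‖) 2 volume := (Lp.memLp ψ).norm
    refine ⟨a1.integrable_mul a2, ?_⟩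
    have a3 := real_inner_le_norm (a1.toLp _) (a2.toLp _)
    rw [L2.inner_def, Lp.norm_toLp, Lp.norm_toLp, eLpNorm_norm, eLpNorm_norm] at a3
    have a4 := eLpNorm_comp_measurePreserving (p := 2) (Lp.aestronglyMeasurable φ)
      (measurePreserving_sub_right volume n.x)
    rw [Function.comp_def] at a4
    rw [a4, ← Lp.norm_def, ← Lp.norm_def] at a3
    refine le_trans (le_of_eq ?_) a3
    refine integral_congr_ae ?_
    filter_upwards [a1.coeFn_toLp, a2.coeFn_toLp] with t t1 t2
    rw [t1, t2, RCLike.inner_apply]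
    simp [mul_comm]
  have hn : ∀ r : Heis × ℝ, ‖g r.1 * (Complex.exp
      ((2 * Real.pi * l * r.1.z - 2 * Real.pi * l * r.1.y * r.2 : ℝ) * Complex.I) *
        φ (r.2 - r.1.x) * star (ψ r.2))‖ = ‖g r.1‖ * (‖φ (r.2 - r.1.x)‖ * ‖ψ r.2‖) := by
    intro r
    rw [norm_mul, norm_mul, norm_mul, Complex.norm_exp_ofReal_mul_I, one_mul, norm_star]
  have hmeas : Measurable fun r : Heis × ℝ => g r.1 * (Complex.exp
      ((2 * Real.pi * l * r.1.z - 2 * Real.pi * l * r.1.y * r.2 : ℝ) * Complex.I) *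
        φ (r.2 - r.1.x) * star (ψ r.2)) := h4.mul ((h3.mul h1).mul h2)
  rw [← integrable_norm_iff hmeas.aestronglyMeasurable]
  simp only [hn]
  have hmeas' : AEStronglyMeasurable
      (fun r : Heis × ℝ => ‖g r.1‖ * (‖φ (r.2 - r.1.x)‖ * ‖ψ r.2‖))
      ((volume : Measure Heis).prod volume) := by
    have := hmeas.norm.aestronglyMeasurable (μ := (volume : Measure Heis).prod volume)
    simpa only [hn] using this
  refine (integrable_prod_iff hmeas').2
    ⟨ae_of_all _ fun n => by exact (key n).1.const_mul ‖g n‖, ?_⟩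
  refine (hg.norm.mul_const (‖φ‖ * ‖ψ‖)).mono' hmeas'.norm.integral_prod_right' ?_
  refine ae_of_all _ fun n => ?_
  rw [Real.norm_of_nonneg (integral_nonneg fun t => norm_nonneg _)]
  simp only [norm_mul, norm_norm]
  rw [integral_const_mul]
  exact mul_le_mul_of_nonneg_left (key n).2 (norm_nonneg _)

/-- The kernel of the group Fourier transform of `g` at `l`. -/
noncomputable def fourierKernel (g : Heis → ℂ) (l t s : ℝ) : ℂ :=
  partialFourier g (t - s) (l * t, l)

theorem inner_groupFourier {g : Heis → ℂ} (hm : Measurable g) (hg : Integrable g) {l : ℝ}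
    {T : L2R →L[ℂ] L2R} (hT : IsGroupFourier g l T) (φ ψ : L2R) :
    Integrable (fun t => (∫ s, fourierKernel g l t s * φ s) * star (ψ t)) ∧
    ⟪ψ, T φ⟫_ℂ = ∫ t, (∫ s, fourierKernel g l t s * φ s) * star (ψ t) := by
  have hint := integrable_groupFourier hm hg l φ ψ
  have e : ∀ᵐ t : ℝ, ∫ n : Heis, g n * (Complex.exp
      ((2 * Real.pi * l * n.z - 2 * Real.pi * l * n.y * t : ℝ) * Complex.I) *
        φ (t - n.x) * star (ψ t)) = (∫ s, fourierKernel g l t s * φ s) * star (ψ t) := by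
    filter_upwards [hint.prod_left_ae] with t ht
    -- The substitution `x = t - s` turns the translate `φ (t - x)` into `φ s`; the phase `2π(λz -
    -- λty)` is that of `planeFourier` at `(λt, λ)`.
    rw [integral_heis ht, ← integral_sub_left_eq_self _ _ t, ← integral_mul_const]
    refine integral_congr_ae (ae_of_all _ fun s => ?_)
    simp only [fourierKernel, partialFourier, planeFourier, Heis.x_mk, Heis.y_mk, Heis.z_mk,
      sub_sub_cancel]
    rw [← integral_mul_const, ← integral_mul_const]
    refine integral_congr_ae (ae_of_all _ fun p => ?_)
    simp only
    rw [show (2 * Real.pi * l * p.2 - 2 * Real.pi * l * p.1 * t : ℝ) =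
      2 * Real.pi * (l * p.2 - l * t * p.1) by ring]
    ring
  refine ⟨hint.integral_prod_right.congr e, ?_⟩
  rw [hT φ ψ, ← integral_congr_ae e]
  rw [← integral_integral_swap (f := fun (n : Heis) (t : ℝ) => g n * (Complex.exp
      ((2 * Real.pi * l * n.z - 2 * Real.pi * l * n.y * t : ℝ) * Complex.I) *
        φ (t - n.x) * star (ψ t))) hint]
  refine integral_congr_ae (ae_of_all _ fun n => ?_)
  simp only
  rw [integral_const_mul, L2.inner_def]
  congr 1
  refine integral_congr_ae ?_
  filter_upwards [(memLp_phase_translate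
      (fun t => 2 * Real.pi * l * n.z - 2 * Real.pi * l * n.y * t) (by fun_prop)
      n.x φ).coeFn_toLp] with t ht
  rw [schrodinger, phaseTranslate, ht, RCLike.inner_apply]
  rfl

/-- The weak definition is tested against indicators of sets of finite measure, which determine a
function almost everywhere. -/
theorem IsGroupFourier.hasKernel {g : Heis → ℂ} (hm : Measurable g) (hg : Integrable g) {l : ℝ}
    {T : L2R →L[ℂ] L2R} (hT : IsGroupFourier g l T) : HasKernel T (fourierKernel g l) := by
  intro φ
  have hind : ∀ s : Set ℝ, MeasurableSet s → volume s < ∞ →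
      IntegrableOn (fun t => ∫ s, fourierKernel g l t s * φ s) s ∧
      ∫ t in s, T φ t = ∫ t in s, ∫ s, fourierKernel g l t s * φ s := by
    intro s hs hfin
    set ψ : L2R := indicatorConstLp 2 hs hfin.ne (1 : ℂ) with hψ
    obtain ⟨h1, h2⟩ := inner_groupFourier hm hg hT φ ψ
    have e : (fun t => (∫ s, fourierKernel g l t s * φ s) * star (ψ t)) =ᵐ[volume]
        s.indicator fun t => ∫ s, fourierKernel g l t s * φ s := by
      filter_upwards [indicatorConstLp_coeFn (p := 2) (hs := hs) (hμs := hfin.ne) (c := (1 : ℂ))]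
        with t ht
      rw [hψ, ht]
      by_cases h : t ∈ s <;> simp [h]
    refine ⟨(integrable_indicator_iff hs).1 (h1.congr e), ?_⟩
    rw [L2.inner_indicatorConstLp_one, integral_congr_ae e, integral_indicator hs] at h2
    exact h2
  refine ae_eq_of_forall_setIntegral_eq_of_sigmaFinite (fun s hs hfin => ?_)
    (fun s hs hfin => (hind s hs hfin).1) (fun s hs hfin => (hind s hs hfin).2)
  have : IsFiniteMeasure (volume.restrict s) := ⟨by rwa [Measure.restrict_apply_univ]⟩
  exact ((Lp.memLp (T φ)).restrict s).integrable (by norm_num)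

/-! ### Plancherel's formula for integrable functions -/

theorem ae_plancherelMeasure_iff {p : ℝ → Prop} :
    (∀ᵐ l ∂plancherelMeasure, p l) ↔ ∀ᵐ l : ℝ, p l := by
  rw [plancherelMeasure, ae_withDensity_iff (by fun_prop)]
  constructor
  · intro h
    filter_upwards [h, Measure.ae_ne volume (0 : ℝ)] with l h1 h2
    exact h1 (by simpa using h2)
  · intro h
    filter_upwards [h] with l h1 _ using h1

theorem lintegral_plancherelMeasure (F : ℝ → ℝ≥0∞) :
    ∫⁻ l, F l ∂plancherelMeasure = ∫⁻ l, ‖l‖ₑ * F l := by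
  rw [plancherelMeasure]
  exact lintegral_withDensity_eq_lintegral_mul_non_measurable _ (by fun_prop)
    (ae_of_all _ fun l => by simp) F

/-- For fixed `λ ≠ 0` the substitutions `x = t - s` and `w = λt` have Jacobians `1` and `|λ|`; the
second is exactly the Plancherel density. -/
theorem lintegral_kernel_change {Φ : ℝ × (ℝ × ℝ) → ℝ≥0∞} (hΦ : Measurable Φ) :
    ∫⁻ l, (∫⁻ t : ℝ, ∫⁻ s : ℝ, Φ (t - s, (l * t, l))) ∂plancherelMeasure =
      ∫⁻ x : ℝ, ∫⁻ q : ℝ × ℝ, Φ (x, q) := by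
  have e1 : ∀ l t : ℝ, ∫⁻ s : ℝ, Φ (t - s, (l * t, l)) = ∫⁻ x : ℝ, Φ (x, (l * t, l)) :=
    fun l t => lintegral_sub_left_eq_self (fun x => Φ (x, (l * t, l))) t
  have hΨ : Measurable fun q : ℝ × ℝ => ∫⁻ x : ℝ, Φ (x, q) := hΦ.lintegral_prod_left'
  have e2 : ∀ l : ℝ, l ≠ 0 → ‖l‖ₑ * ∫⁻ t : ℝ, ∫⁻ x : ℝ, Φ (x, (l * t, l)) =
      ∫⁻ w : ℝ, ∫⁻ x : ℝ, Φ (x, (w, l)) := by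
    intro l hl
    have hm : Measurable fun w : ℝ => ∫⁻ x : ℝ, Φ (x, (w, l)) :=
      hΨ.comp (measurable_id.prodMk measurable_const)
    have h := lintegral_map (μ := volume) hm (measurable_const_mul l)
    rw [Real.map_volume_mul_left hl, lintegral_smul_measure] at h
    rw [← h, smul_eq_mul, ← mul_assoc, ← ofReal_norm, ← ENNReal.ofReal_mul (norm_nonneg _),
      Real.norm_eq_abs, ← abs_mul, mul_inv_cancel₀ hl]
    simp
  simp only [e1]
  rw [lintegral_plancherelMeasure]
  have e3 : ∫⁻ l : ℝ, ‖l‖ₑ * ∫⁻ t : ℝ, ∫⁻ x : ℝ, Φ (x, (l * t, l)) =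
      ∫⁻ l : ℝ, ∫⁻ w : ℝ, ∫⁻ x : ℝ, Φ (x, (w, l)) := by
    refine lintegral_congr_ae ?_
    filter_upwards [Measure.ae_ne volume (0 : ℝ)] with l hl using e2 l hl
  rw [e3, ← lintegral_prod_symm' (fun q : ℝ × ℝ => ∫⁻ x : ℝ, Φ (x, q)) hΨ]
  exact (lintegral_lintegral_swap (f := fun (x : ℝ) (q : ℝ × ℝ) => Φ (x, q))
    hΦ.aemeasurable).symm

/-- If `Φ` has finite integral, then for almost all `l` and `t` so has its slice. -/
theorem ae_slice_lt_top {Φ : ℝ × (ℝ × ℝ) → ℝ≥0∞} (hΦ : Measurable Φ)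
    (h : ∫⁻ x : ℝ, ∫⁻ q : ℝ × ℝ, Φ (x, q) < ∞) :
    ∀ᵐ l : ℝ, ∀ᵐ t : ℝ, ∫⁻ s : ℝ, Φ (t - s, (l * t, l)) < ∞ := by
  rw [← lintegral_kernel_change hΦ] at h
  have h1 : Measurable fun r : ℝ × ℝ => ∫⁻ s : ℝ, Φ (r.2 - s, (r.1 * r.2, r.1)) :=
    Measurable.lintegral_prod_right' (f := fun u : (ℝ × ℝ) × ℝ =>
      Φ (u.1.2 - u.2, (u.1.1 * u.1.2, u.1.1))) (hΦ.comp (by fun_prop))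
  have h2 := ae_lt_top (h1.lintegral_prod_right' (ν := volume)) h.ne
  rw [ae_plancherelMeasure_iff] at h2
  filter_upwards [h2] with l hl
  exact ae_lt_top (h1.comp (measurable_const.prodMk measurable_id)) hl.ne

theorem lintegral_hsNormSq_of_hasKernel {T : ℝ → L2R →L[ℂ] L2R} {K : ℝ → ℝ × ℝ → ℂ}
    (hK : Measurable fun r : ℝ × (ℝ × ℝ) => K r.1 r.2)
    (hfin : ∫⁻ x : ℝ, ∫⁻ q : ℝ × ℝ, ‖K x q‖ₑ ^ 2 < ∞)
    (hT : ∀ᵐ l : ℝ, HasKernel (T l) fun t s => K (t - s) (l * t, l)) :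
    ∫⁻ l, hsNormSq (T l) ∂plancherelMeasure = ∫⁻ x : ℝ, ∫⁻ q : ℝ × ℝ, ‖K x q‖ₑ ^ 2 := by
  have hΦ : Measurable fun r : ℝ × (ℝ × ℝ) => ‖K r.1 r.2‖ₑ ^ 2 := hK.enorm.pow_const 2
  rw [← lintegral_kernel_change hΦ]
  refine lintegral_congr_ae (ae_plancherelMeasure_iff.2 ?_)
  filter_upwards [hT, ae_slice_lt_top hΦ hfin] with l hl hs
  have hm : Measurable fun r : ℝ × ℝ => K (r.1 - r.2) (l * r.1, l) :=
    hK.comp (f := fun r : ℝ × ℝ => (r.1 - r.2, (l * r.1, l))) (by fun_prop)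
  refine hl.hsNormSq_eq hm ?_
  filter_upwards [hs] with t ht
  refine (memLp_two_iff_lintegral ?_).2 ht
  exact (hm.comp (measurable_const.prodMk measurable_id)).aestronglyMeasurable

theorem ae_memLp_kernel {K : ℝ → ℝ × ℝ → ℂ}
    (hK : Measurable fun r : ℝ × (ℝ × ℝ) => K r.1 r.2)
    (hfin : ∫⁻ x : ℝ, ∫⁻ q : ℝ × ℝ, ‖K x q‖ₑ ^ 2 < ∞) :
    ∀ᵐ l : ℝ, ∀ᵐ t : ℝ, MemLp (fun s => K (t - s) (l * t, l)) 2 volume := by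
  have hΦ : Measurable fun r : ℝ × (ℝ × ℝ) => ‖K r.1 r.2‖ₑ ^ 2 := hK.enorm.pow_const 2
  filter_upwards [ae_slice_lt_top hΦ hfin] with l hl
  filter_upwards [hl] with t ht
  refine (memLp_two_iff_lintegral ?_).2 ht
  exact (hK.comp (f := fun s : ℝ => (t - s, (l * t, l))) (by fun_prop)).aestronglyMeasurable

theorem isL2Field_of_hasKernel {T : ℝ → L2R →L[ℂ] L2R} {K : ℝ → ℝ × ℝ → ℂ}
    (hK : Measurable fun r : ℝ × (ℝ × ℝ) => K r.1 r.2)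
    (hfin : ∫⁻ x : ℝ, ∫⁻ q : ℝ × ℝ, ‖K x q‖ₑ ^ 2 < ∞)
    (hT : ∀ᵐ l : ℝ, HasKernel (T l) fun t s => K (t - s) (l * t, l)) : IsL2Field T := by
  refine ⟨fun φ ψ => ?_, by rwa [lintegral_hsNormSq_of_hasKernel hK hfin hT]⟩
  have hφ := (Lp.stronglyMeasurable φ).measurable
  have hψ := (Lp.stronglyMeasurable ψ).measurable
  have h1 : StronglyMeasurable fun r : ℝ × ℝ =>
      ∫ s, K (r.2 - s) (r.1 * r.2, r.1) * φ s := by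
    have m1 : Measurable fun u : (ℝ × ℝ) × ℝ => K (u.1.2 - u.2) (u.1.1 * u.1.2, u.1.1) :=
      hK.comp (f := fun u : (ℝ × ℝ) × ℝ => (u.1.2 - u.2, (u.1.1 * u.1.2, u.1.1))) (by fun_prop)
    exact (m1.mul (hφ.comp measurable_snd)).stronglyMeasurable.integral_prod_right'
  have h2 : StronglyMeasurable fun l : ℝ =>
      ∫ t, (∫ s, K (t - s) (l * t, l) * φ s) * star (ψ t) :=
    ((h1.measurable.mul (continuous_star.measurable.comp
      (hψ.comp measurable_snd))).stronglyMeasurable.integral_prod_right' (ν := volume))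
  refine h2.measurable.aemeasurable.congr ?_
  filter_upwards [hT] with l hl
  rw [L2.inner_def]
  refine integral_congr_ae ?_
  filter_upwards [hl φ] with t ht
  rw [ht, RCLike.inner_apply]
  rfl

theorem lintegral_enorm_sq_lt_top (f : L2H) : ∫⁻ n, ‖f n‖ₑ ^ 2 < ∞ := by
  rw [← enorm_sq_eq_lintegral]
  finiteness

theorem hasKernel_groupFourier {g : L2H} (hg : Integrable g volume) {G : ℝ → L2R →L[ℂ] L2R}
    (hG : ∀ l, l ≠ 0 → IsGroupFourier g l (G l)) :
    ∀ᵐ l : ℝ, HasKernel (G l) fun t s => partialFourier g (t - s) (l * t, l) := by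
  filter_upwards [Measure.ae_ne volume (0 : ℝ)] with l hl
  exact (hG l hl).hasKernel (Lp.stronglyMeasurable g).measurable hg

theorem isL2Field_groupFourier {g : L2H} (hg : Integrable g volume) {G : ℝ → L2R →L[ℂ] L2R}
    (hG : ∀ l, l ≠ 0 → IsGroupFourier g l (G l)) : IsL2Field G := by
  have hm := (Lp.stronglyMeasurable g).measurable
  refine isL2Field_of_hasKernel (stronglyMeasurable_partialFourier hm).measurable ?_
    (hasKernel_groupFourier hg hG)
  rw [lintegral_partialFourier hm hg (lintegral_enorm_sq_lt_top g)]
  exact lintegral_enorm_sq_lt_top g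

theorem lintegral_hsNormSq_groupFourier {g : L2H} (hg : Integrable g volume)
    {G : ℝ → L2R →L[ℂ] L2R} (hG : ∀ l, l ≠ 0 → IsGroupFourier g l (G l)) :
    ∫⁻ l, hsNormSq (G l) ∂plancherelMeasure = ‖g‖ₑ ^ 2 := by
  have hm := (Lp.stronglyMeasurable g).measurable
  have h := lintegral_partialFourier hm hg (lintegral_enorm_sq_lt_top g)
  rw [enorm_sq_eq_lintegral, ← h]
  refine lintegral_hsNormSq_of_hasKernel (stronglyMeasurable_partialFourier hm).measurable ?_
    (hasKernel_groupFourier hg hG)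
  rw [h]
  exact lintegral_enorm_sq_lt_top g

/-! ### Plancherel's formula -/

/-- Young's inequality `2ab ≤ εa² + ε⁻¹b²`. The constant at `x` tends to `1` with `ε`, so after
integration this plays the role of continuity of the norm in the direct integral. -/
theorem enorm_add_sq_le {E : Type*} [NormedAddCommGroup E] (x y : E) {ε : ℝ} (hε : 0 < ε) :
    ‖x + y‖ₑ ^ 2 ≤ ENNReal.ofReal (1 + ε) * ‖x‖ₑ ^ 2 +
      ENNReal.ofReal (1 + ε⁻¹) * ‖y‖ₑ ^ 2 := by
  have h : ‖x + y‖ ^ 2 ≤ (1 + ε) * ‖x‖ ^ 2 + (1 + ε⁻¹) * ‖y‖ ^ 2 := by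
    have h1 : ‖x + y‖ ^ 2 ≤ (‖x‖ + ‖y‖) ^ 2 := by gcongr; exact norm_add_le x y
    have h2 : 0 ≤ ε⁻¹ * (ε * ‖x‖ - ‖y‖) ^ 2 := by positivity
    have h3 : ε⁻¹ * (ε * ‖x‖ - ‖y‖) ^ 2 = ε * ‖x‖ ^ 2 - 2 * ‖x‖ * ‖y‖ + ε⁻¹ * ‖y‖ ^ 2 := by
      field_simp
      ring
    nlinarith
  simp only [← ofReal_norm]
  rw [← ENNReal.ofReal_pow (norm_nonneg _), ← ENNReal.ofReal_pow (norm_nonneg _),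
    ← ENNReal.ofReal_pow (norm_nonneg _), ← ENNReal.ofReal_mul (by positivity),
    ← ENNReal.ofReal_mul (by positivity), ← ENNReal.ofReal_add (by positivity) (by positivity)]
  exact ENNReal.ofReal_le_ofReal h

theorem hsNormSq_add_le_of_pos (A B : L2R →L[ℂ] L2R) {ε : ℝ} (hε : 0 < ε) :
    hsNormSq (A + B) ≤ ENNReal.ofReal (1 + ε) * hsNormSq A +
      ENNReal.ofReal (1 + ε⁻¹) * hsNormSq B := by
  simp only [hsNormSq]
  rw [← ENNReal.tsum_mul_left, ← ENNReal.tsum_mul_left, ← ENNReal.tsum_add]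
  exact ENNReal.tsum_le_tsum fun e => enorm_add_sq_le _ _ hε

theorem lintegral_hsNormSq_add_le_of_pos {A B : ℝ → L2R →L[ℂ] L2R}
    (hA : ∀ φ ψ : L2R, AEMeasurable (fun l => ⟪ψ, A l φ⟫_ℂ) volume) {ε : ℝ} (hε : 0 < ε) :
    ∫⁻ l, hsNormSq (A l + B l) ∂plancherelMeasure ≤
      ENNReal.ofReal (1 + ε) * ∫⁻ l, hsNormSq (A l) ∂plancherelMeasure +
      ENNReal.ofReal (1 + ε⁻¹) * ∫⁻ l, hsNormSq (B l) ∂plancherelMeasure := by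
  rw [← lintegral_const_mul' _ _ (by simp), ← lintegral_const_mul' _ _ (by simp),
    ← lintegral_add_left' ((aemeasurable_hsNormSq hA).const_mul _)]
  exact lintegral_mono fun l => hsNormSq_add_le_of_pos _ _ hε

theorem le_of_forall_one_add_mul_le {a b : ℝ≥0∞}
    (h : ∀ ε : ℝ, 0 < ε → a ≤ ENNReal.ofReal (1 + ε) * b) : a ≤ b := by
  have h1 : Tendsto (fun ε : ℝ => ENNReal.ofReal (1 + ε) * b) (𝓝[>] 0) (𝓝 (1 * b)) := by
    refine ENNReal.Tendsto.mul_const ?_ (Or.inl one_ne_zero)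
    have h2 : Tendsto (fun ε : ℝ => ENNReal.ofReal (1 + ε)) (𝓝 0) (𝓝 (ENNReal.ofReal (1 + 0))) :=
      (ENNReal.continuous_ofReal.comp (continuous_const.add continuous_id)).tendsto 0
    simpa using h2.mono_left nhdsWithin_le_nhds
  rw [one_mul] at h1
  refine ge_of_tendsto h1 ?_
  filter_upwards [self_mem_nhdsWithin] with ε hε using h ε hε

theorem hsNormSq_neg (A : L2R →L[ℂ] L2R) : hsNormSq (-A) = hsNormSq A := by
  simp [hsNormSq]

/-- The formula holds for the integrable approximants. Writing `T = G k - (G k - T)` and `G k = T +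
(G k - T)` gives both inequalities up to a factor `1 + ε` and an error that vanishes as `k → ∞`;
then `ε → 0`. -/
theorem IsPlancherelTransform.lintegral_hsNormSq {f : L2H} {T : ℝ → L2R →L[ℂ] L2R}
    (h : IsPlancherelTransform f T) : ∫⁻ l, hsNormSq (T l) ∂plancherelMeasure = ‖f‖ₑ ^ 2 := by
  obtain ⟨hT, g, G, hi, hF, hG, hg, hlim⟩ := h
  have hn : ∀ k, ∫⁻ l, hsNormSq (G k l) ∂plancherelMeasure = ‖g k‖ₑ ^ 2 := fun k =>
    lintegral_hsNormSq_groupFourier (hi k) (hF k)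
  have hlim1 : Tendsto (fun k => ‖g k‖ₑ ^ 2) atTop (𝓝 (‖f‖ₑ ^ 2)) :=
    ((ENNReal.continuous_pow 2).tendsto _).comp ((continuous_enorm.tendsto f).comp hg)
  have hzero : ∀ ε : ℝ, Tendsto (fun k => ENNReal.ofReal (1 + ε⁻¹) *
      ∫⁻ l, hsNormSq (G k l - T l) ∂plancherelMeasure) atTop (𝓝 0) := fun ε => by
    simpa using ENNReal.Tendsto.const_mul (a := ENNReal.ofReal (1 + ε⁻¹)) hlim
      (Or.inr (by simp))
  refine le_antisymm ?_ ?_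
  · refine le_of_forall_one_add_mul_le fun ε hε => ?_
    have h1 : Tendsto (fun k => ENNReal.ofReal (1 + ε) * ‖g k‖ₑ ^ 2 + ENNReal.ofReal (1 + ε⁻¹) *
        ∫⁻ l, hsNormSq (G k l - T l) ∂plancherelMeasure) atTop
        (𝓝 (ENNReal.ofReal (1 + ε) * ‖f‖ₑ ^ 2 + 0)) :=
      (ENNReal.Tendsto.const_mul hlim1 (Or.inr (by simp))).add (hzero ε)
    rw [add_zero] at h1
    refine ge_of_tendsto' h1 fun k => ?_
    have e : ∀ l, T l = G k l + -(G k l - T l) := fun l => by abel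
    have h2 := lintegral_hsNormSq_add_le_of_pos (B := fun l => -(G k l - T l)) (hG k).1 hε
    simp only [← e, hsNormSq_neg, hn] at h2
    exact h2
  · refine le_of_forall_one_add_mul_le fun ε hε => ?_
    have h1 : Tendsto (fun k => ENNReal.ofReal (1 + ε) *
        ∫⁻ l, hsNormSq (T l) ∂plancherelMeasure + ENNReal.ofReal (1 + ε⁻¹) *
        ∫⁻ l, hsNormSq (G k l - T l) ∂plancherelMeasure) atTop
        (𝓝 (ENNReal.ofReal (1 + ε) * ∫⁻ l, hsNormSq (T l) ∂plancherelMeasure + 0)) :=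
      tendsto_const_nhds.add (hzero ε)
    rw [add_zero] at h1
    refine le_of_tendsto_of_tendsto' hlim1 h1 fun k => ?_
    have h2 := lintegral_hsNormSq_add_le_of_pos (A := T) (B := fun l => G k l - T l) hT.1 hε
    simp only [add_sub_cancel, hn] at h2
    exact h2

/-! ### Polarization -/

theorem hasSum_norm_sq_of_hsNormSq_lt_top {A : L2R →L[ℂ] L2R} (hA : hsNormSq A < ∞) :
    HasSum (fun e : onbL2R => ‖A (e : L2R)‖ ^ 2) (hsNormSq A).toReal := by
  have h := ENNReal.hasSum_toReal (f := fun e : onbL2R => ‖A (e : L2R)‖ₑ ^ 2) hA.ne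
  simp only [ENNReal.toReal_pow, toReal_enorm] at h
  rw [hsNormSq, ENNReal.tsum_toReal_eq fun e => by finiteness]
  simpa only [ENNReal.toReal_pow, toReal_enorm] using h

theorem hasSum_inner_mul_inner_onbL2R (x y : L2R) :
    HasSum (fun e : onbL2R => ⟪x, (e : L2R)⟫_ℂ * ⟪(e : L2R), y⟫_ℂ) ⟪x, y⟫_ℂ := by
  obtain ⟨b, hb⟩ := (exists_hilbertBasis ℂ L2R).choose_spec
  have h := b.hasSum_inner_mul_inner x y
  have e : ∀ i, b i = ((i : onbL2R) : L2R) := fun i => congrFun hb i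
  simp only [e] at h
  exact h

theorem hsNormSq_rankOne (u v : L2R) :
    hsNormSq (InnerProductSpace.rankOne ℂ u v) = ‖v‖ₑ ^ 2 * ‖u‖ₑ ^ 2 := by
  simp only [hsNormSq, InnerProductSpace.rankOne_apply, enorm_smul, mul_pow,
    ENNReal.tsum_mul_right]
  rw [enorm_sq_eq_tsum v]
  congr 1
  refine tsum_congr fun e => ?_
  rw [← ofReal_norm, norm_inner_symm, ofReal_norm]

theorem hsNormSq_add_lt_top {A B : L2R →L[ℂ] L2R} (hA : hsNormSq A < ∞) (hB : hsNormSq B < ∞) :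
    hsNormSq (A + B) < ∞ :=
  (hsNormSq_add_le A B).trans_lt
    (ENNReal.mul_lt_top (by simp) (ENNReal.add_lt_top.2 ⟨hA, hB⟩))

theorem hsNormSq_smul_lt_top (c : ℂ) {A : L2R →L[ℂ] L2R} (hA : hsNormSq A < ∞) :
    hsNormSq (c • A) < ∞ := by
  rw [hsNormSq_smul]
  exact ENNReal.mul_lt_top (by finiteness) hA

theorem hasSum_inner_of_hasSum_norm_sq {E ι : Type*} [NormedAddCommGroup E]
    [InnerProductSpace ℂ E] {x y : ι → E} {q : ℂ → ℝ}
    (h : ∀ c : ℂ, HasSum (fun i => ‖x i + c • y i‖ ^ 2) (q c)) :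
    HasSum (fun i => ⟪x i, y i⟫_ℂ)
      (((q 1 : ℂ) - (q (-1) : ℂ) +
        ((q (-Complex.I) : ℂ) - (q Complex.I : ℂ)) * Complex.I) / 4) := by
  have hs : ∀ c : ℂ, HasSum (fun i => ((‖x i + c • y i‖ ^ 2 : ℝ) : ℂ)) (q c : ℂ) :=
    fun c => Complex.hasSum_ofReal.2 (h c)
  have h1 := ((((hs 1).sub (hs (-1))).add
    (((hs (-Complex.I)).sub (hs Complex.I)).mul_right Complex.I)).div_const 4)
  refine h1.congr_fun ?_
  intro i
  rw [inner_eq_sum_norm_sq_div_four]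
  simp [sub_eq_add_neg]

theorem hasSum_inner_of_hsNormSq_lt_top {F H : L2R →L[ℂ] L2R} (hF : hsNormSq F < ∞)
    (hH : hsNormSq H < ∞) :
    HasSum (fun e : onbL2R => ⟪F (e : L2R), H (e : L2R)⟫_ℂ)
      ((((hsNormSq (F + (1 : ℂ) • H)).toReal : ℂ) - ((hsNormSq (F + (-1 : ℂ) • H)).toReal : ℂ) +
       (((hsNormSq (F + (-Complex.I) • H)).toReal : ℂ) -
        ((hsNormSq (F + Complex.I • H)).toReal : ℂ)) * Complex.I) / 4) := by
  refine hasSum_inner_of_hasSum_norm_sq (q := fun c => (hsNormSq (F + c • H)).toReal) fun c => ?_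
  have h := hasSum_norm_sq_of_hsNormSq_lt_top (hsNormSq_add_lt_top hF (hsNormSq_smul_lt_top c hH))
  simpa only [add_apply, smul_apply] using h

/-- The left side is the Hilbert–Schmidt inner product of `u ⊗ v` with `H`, which polarization
expresses by norms. Only norms have been computed so far, so this form can be integrated in `λ`. -/
theorem inner_apply_eq_polarization (u v : L2R) {H : L2R →L[ℂ] L2R} (hH : hsNormSq H < ∞) :
    ⟪u, H v⟫_ℂ =
      (((hsNormSq (InnerProductSpace.rankOne ℂ u v + (1 : ℂ) • H)).toReal : ℂ) -
        ((hsNormSq (InnerProductSpace.rankOne ℂ u v + (-1 : ℂ) • H)).toReal : ℂ) +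
       (((hsNormSq (InnerProductSpace.rankOne ℂ u v + (-Complex.I) • H)).toReal : ℂ) -
        ((hsNormSq (InnerProductSpace.rankOne ℂ u v + Complex.I • H)).toReal : ℂ)) *
          Complex.I) / 4 := by
  have hF : hsNormSq (InnerProductSpace.rankOne ℂ u v) < ∞ := by
    rw [hsNormSq_rankOne]; finiteness
  have h1 := hasSum_inner_of_hsNormSq_lt_top hF hH
  have h2 : HasSum (fun e : onbL2R => ⟪InnerProductSpace.rankOne ℂ u v (e : L2R),
      H (e : L2R)⟫_ℂ) ⟪u, H v⟫_ℂ := by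
    -- Each term is `⟨H* u, e⟩ ⟨e, v⟩`, so the sum is `⟨H* u, v⟩`.
    have h3 := hasSum_inner_mul_inner_onbL2R (ContinuousLinearMap.adjoint H u) v
    rw [ContinuousLinearMap.adjoint_inner_left] at h3
    convert h3 using 2 with e
    rw [InnerProductSpace.rankOne_apply, inner_smul_left, inner_conj_symm,
      ContinuousLinearMap.adjoint_inner_left, mul_comm]
  exact h2.unique h1

theorem IsPlancherelTransform.hsNormSq_lt_top {f : L2H} {T : ℝ → L2R →L[ℂ] L2R}
    (h : IsPlancherelTransform f T) : ∀ᵐ l, hsNormSq (T l) < ∞ :=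
  ae_plancherelMeasure_iff.1
    (ae_lt_top' (aemeasurable_hsNormSq h.1.1) h.1.2.ne)

theorem IsPlancherelTransform.integral_hsNormSq {f : L2H} {T : ℝ → L2R →L[ℂ] L2R}
    (h : IsPlancherelTransform f T) :
    Integrable (fun l => (hsNormSq (T l)).toReal) plancherelMeasure ∧
    ∫ l, (hsNormSq (T l)).toReal ∂plancherelMeasure = ‖f‖ ^ 2 := by
  have hm := aemeasurable_hsNormSq h.1.1
  refine ⟨integrable_toReal_of_lintegral_ne_top hm h.1.2.ne, ?_⟩
  rw [integral_toReal hm (ae_lt_top' hm h.1.2.ne), h.lintegral_hsNormSq]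
  simp

/-- Plancherel's formula is applied to `f + c h` for `c = ±1, ±i`, and the four identities are
combined by polarization in `L²(ℍ)` and at each `λ`. -/
theorem IsPlancherelTransform.inner_eq_integral {f h : L2H} {u v : ℝ → L2R}
    {H : ℝ → L2R →L[ℂ] L2R}
    (hf : IsPlancherelTransform f fun l => InnerProductSpace.rankOne ℂ (u l) (v l))
    (hh : IsPlancherelTransform h H) :
    ⟪f, h⟫_ℂ = ∫ l, ⟪u l, H l (v l)⟫_ℂ ∂plancherelMeasure := by
  have hi : ∀ c : ℂ, Integrable (fun l => ((hsNormSq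
      (InnerProductSpace.rankOne ℂ (u l) (v l) + c • H l)).toReal : ℂ)) plancherelMeasure ∧
      ∫ l, ((hsNormSq (InnerProductSpace.rankOne ℂ (u l) (v l) + c • H l)).toReal : ℂ)
        ∂plancherelMeasure = ((‖f + c • h‖ ^ 2 : ℝ) : ℂ) := fun c => by
    have h1 := (hf.add (hh.smul c)).integral_hsNormSq
    exact ⟨h1.1.ofReal, by rw [← h1.2]; exact integral_ofReal⟩
  have e : ∀ᵐ l ∂plancherelMeasure, ⟪u l, H l (v l)⟫_ℂ = _ :=
    ae_plancherelMeasure_iff.2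
      (hh.hsNormSq_lt_top.mono fun l hl => inner_apply_eq_polarization (u l) (v l) hl)
  rw [integral_congr_ae e, integral_div, integral_add, integral_sub, integral_mul_const,
    integral_sub, (hi 1).2, (hi (-1)).2, (hi _).2, (hi _).2, inner_eq_sum_norm_sq_div_four]
  · simp [sub_eq_add_neg]
  · exact (hi _).1
  · exact (hi _).1
  · exact (hi _).1
  · exact (hi _).1
  · exact (hi _).1.sub (hi _).1
  · exact ((hi _).1.sub (hi _).1).mul_const _

/-! ### The Schrödinger representation -/

theorem coeFn_phaseTranslate (θ : ℝ → ℝ) (hθ : Measurable θ) (a : ℝ) (g : L2R) :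
    phaseTranslate θ hθ a g =ᵐ[volume] fun t => Complex.exp (θ t * Complex.I) * g (t - a) :=
  (memLp_phase_translate θ hθ a g).coeFn_toLp

theorem ae_comp_sub {p : ℝ → Prop} (h : ∀ᵐ t : ℝ, p t) (a : ℝ) : ∀ᵐ t : ℝ, p (t - a) :=
  (measurePreserving_sub_right volume a).quasiMeasurePreserving.ae h

theorem phaseTranslate_add (θ : ℝ → ℝ) (hθ : Measurable θ) (a : ℝ) (g h : L2R) :
    phaseTranslate θ hθ a (g + h) = phaseTranslate θ hθ a g + phaseTranslate θ hθ a h := by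
  refine Lp.ext ?_
  filter_upwards [coeFn_phaseTranslate θ hθ a (g + h), coeFn_phaseTranslate θ hθ a g,
    coeFn_phaseTranslate θ hθ a h, Lp.coeFn_add (phaseTranslate θ hθ a g)
      (phaseTranslate θ hθ a h), ae_comp_sub (Lp.coeFn_add g h) a] with t h1 h2 h3 h4 h5
  rw [h1, h4, Pi.add_apply, h2, h3, h5, Pi.add_apply, mul_add]

theorem phaseTranslate_smul (θ : ℝ → ℝ) (hθ : Measurable θ) (a : ℝ) (c : ℂ) (g : L2R) :
    phaseTranslate θ hθ a (c • g) = c • phaseTranslate θ hθ a g := by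
  refine Lp.ext ?_
  filter_upwards [coeFn_phaseTranslate θ hθ a (c • g), coeFn_phaseTranslate θ hθ a g,
    Lp.coeFn_smul c (phaseTranslate θ hθ a g), ae_comp_sub (Lp.coeFn_smul c g) a]
    with t h1 h2 h3 h4
  rw [h1, h3, Pi.smul_apply, h2, h4, Pi.smul_apply, smul_eq_mul, smul_eq_mul, mul_left_comm]

theorem schrodinger_mul (l : ℝ) (n m : Heis) (φ : L2R) :
    schrodinger l (n * m) φ = schrodinger l n (schrodinger l m φ) := by
  refine Lp.ext ?_
  simp only [schrodinger]
  filter_upwards [coeFn_phaseTranslate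
      (fun t => 2 * Real.pi * l * (n * m).z - 2 * Real.pi * l * (n * m).y * t) (by fun_prop)
      (n * m).x φ,
    coeFn_phaseTranslate (fun t => 2 * Real.pi * l * n.z - 2 * Real.pi * l * n.y * t)
      (by fun_prop) n.x (schrodinger l m φ),
    ae_comp_sub (coeFn_phaseTranslate (fun t => 2 * Real.pi * l * m.z - 2 * Real.pi * l * m.y * t)
      (by fun_prop) m.x φ) n.x] with t h1 h2 h3
  simp only [schrodinger] at h2
  rw [h1, h2, h3, ← mul_assoc, ← Complex.exp_add, Heis.x_mul, Heis.y_mul, Heis.z_mul,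
    sub_sub]
  congr 2
  push_cast
  ring

theorem schrodinger_one (l : ℝ) (φ : L2R) : schrodinger l 1 φ = φ := by
  refine Lp.ext ?_
  filter_upwards [coeFn_phaseTranslate
      (fun t => 2 * Real.pi * l * (1 : Heis).z - 2 * Real.pi * l * (1 : Heis).y * t)
      (by fun_prop) (1 : Heis).x φ] with t h1
  rw [schrodinger, h1]
  simp

/-- The operators of the Schrödinger representation as linear isometries. -/
noncomputable def schrodingerIsometry (l : ℝ) (n : Heis) : L2R →ₗᵢ[ℂ] L2R where
  toFun := schrodinger l n
  map_add' := phaseTranslate_add _ (by fun_prop) _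
  map_smul' := phaseTranslate_smul _ (by fun_prop) _
  norm_map' := norm_phaseTranslate _ (by fun_prop) _

@[simp] theorem schrodingerIsometry_apply (l : ℝ) (n : Heis) (φ : L2R) :
    schrodingerIsometry l n φ = schrodinger l n φ := rfl

theorem schrodinger_schrodinger_inv (l : ℝ) (n : Heis) (φ : L2R) :
    schrodinger l n (schrodinger l n⁻¹ φ) = φ := by
  rw [← schrodinger_mul, mul_inv_cancel, schrodinger_one]

theorem inner_schrodinger_right (l : ℝ) (n : Heis) (φ ψ : L2R) :
    ⟪ψ, schrodinger l n φ⟫_ℂ = ⟪schrodinger l n⁻¹ ψ, φ⟫_ℂ := by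
  have h := (schrodingerIsometry l n).inner_map_map (schrodinger l n⁻¹ ψ) φ
  rwa [schrodingerIsometry_apply, schrodingerIsometry_apply, schrodinger_schrodinger_inv] at h

theorem inner_schrodinger_left (l : ℝ) (n : Heis) (φ ψ : L2R) :
    ⟪schrodinger l n ψ, φ⟫_ℂ = ⟪ψ, schrodinger l n⁻¹ φ⟫_ℂ := by
  rw [inner_schrodinger_right, inv_inv]

theorem measurable_inner_schrodinger (n : Heis) (φ ψ : L2R) :
    Measurable fun l : ℝ => ⟪ψ, schrodinger l n φ⟫_ℂ := by
  have e : (fun l : ℝ => ⟪ψ, schrodinger l n φ⟫_ℂ) = fun l : ℝ => ∫ t : ℝ,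
      (Complex.exp (((2 * Real.pi * l * n.z - 2 * Real.pi * l * n.y * t : ℝ) : ℂ) * Complex.I) *
        φ (t - n.x)) * star (ψ t) := by
    funext l
    rw [L2.inner_def]
    refine integral_congr_ae ?_
    filter_upwards [coeFn_phaseTranslate
      (fun t => 2 * Real.pi * l * n.z - 2 * Real.pi * l * n.y * t) (by fun_prop) n.x φ] with t ht
    rw [schrodinger, ht, RCLike.inner_apply]
    rfl
  rw [e]
  have h1 : Measurable fun q : ℝ × ℝ => φ (q.2 - n.x) :=
    (Lp.stronglyMeasurable φ).measurable.comp (measurable_snd.sub_const _)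
  have h2 : Measurable fun q : ℝ × ℝ => star (ψ q.2) :=
    continuous_star.measurable.comp ((Lp.stronglyMeasurable ψ).measurable.comp measurable_snd)
  have h3 : Measurable fun q : ℝ × ℝ => Complex.exp
      (((2 * Real.pi * q.1 * n.z - 2 * Real.pi * q.1 * n.y * q.2 : ℝ) : ℂ) * Complex.I) := by
    fun_prop
  exact (((h3.mul h1).mul h2).stronglyMeasurable.integral_prod_right').measurable

/-! ### Existence of the group Fourier transform of an integrable function -/

/-- The weak integral is a sesquilinear form bounded by the `L¹` norm of `g`, hence is represented
by a bounded operator. -/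
theorem exists_isGroupFourier {g : Heis → ℂ} (hg : Integrable g volume) (l : ℝ) :
    ∃ T, IsGroupFourier g l T := by
  have hi := integrable_mul_inner_schrodinger hg l
  let B : L2R →ₗ⋆[ℂ] L2R →ₗ[ℂ] ℂ := LinearMap.mk₂'ₛₗ (starRingEnd ℂ) (RingHom.id ℂ)
    -- The conjugate makes the form antilinear in `φ` and linear in `ψ`, as the representation
    -- theorem requires; it is undone at the end.
    (fun φ ψ => starRingEnd ℂ (∫ n : Heis, g n * ⟪ψ, schrodinger l n φ⟫_ℂ))
    (fun φ φ' ψ => by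
      rw [← map_add, ← integral_add (hi φ ψ) (hi φ' ψ)]
      congr 2 with n
      rw [← mul_add, ← inner_add_right]
      congr 2
      exact (schrodingerIsometry l n).map_add φ φ')
    (fun c φ ψ => by
      rw [smul_eq_mul, ← map_mul, ← integral_const_mul]
      congr 2 with n
      rw [← schrodingerIsometry_apply, map_smul, inner_smul_right, mul_left_comm,
        schrodingerIsometry_apply])
    (fun φ ψ ψ' => by
      rw [← map_add, ← integral_add (hi φ ψ) (hi φ ψ')]
      congr 2 with n
      rw [← mul_add, ← inner_add_left])
    (fun c φ ψ => by
      simp only [RingHom.id_apply, smul_eq_mul]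
      rw [← Complex.conj_conj c, ← map_mul, ← integral_const_mul]
      congr 2 with n
      rw [mul_left_comm, inner_smul_left]
      simp)
  have hB : ∀ φ ψ, ‖B φ ψ‖ ≤ (∫ n, ‖g n‖) * ‖φ‖ * ‖ψ‖ := by
    intro φ ψ
    change ‖starRingEnd ℂ (∫ n : Heis, g n * ⟪ψ, schrodinger l n φ⟫_ℂ)‖ ≤ _
    rw [RCLike.norm_conj, mul_assoc, ← integral_mul_const]
    refine norm_integral_le_of_norm_le (hg.norm.mul_const _) (ae_of_all _ fun n => ?_)
    rw [norm_mul]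
    refine mul_le_mul_of_nonneg_left ?_ (norm_nonneg _)
    refine (norm_inner_le_norm _ _).trans_eq ?_
    rw [schrodinger, norm_phaseTranslate, mul_comm]
  refine ⟨InnerProductSpace.continuousLinearMapOfBilin
    (B.mkContinuous₂ (∫ n, ‖g n‖) hB), fun φ ψ => ?_⟩
  rw [← inner_conj_symm, InnerProductSpace.continuousLinearMapOfBilin_apply,
    LinearMap.mkContinuous₂_apply]
  exact Complex.conj_conj _

/-! ### Tight systems and the Hilbert–Schmidt norm -/

/-- Parseval's identity holds for the family `e` in `L²(ℝ)`. -/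
def SatisfiesParseval {ι : Type*} (e : ι → L2R) : Prop :=
  ∀ x : L2R, ∑' i, ‖⟪e i, x⟫_ℂ‖ₑ ^ 2 = ‖x‖ₑ ^ 2

theorem satisfiesParseval_onbL2R : SatisfiesParseval fun e : onbL2R => (e : L2R) :=
  fun x => (enorm_sq_eq_tsum x).symm

theorem enorm_inner_symm (x y : L2R) : ‖⟪x, y⟫_ℂ‖ₑ = ‖⟪y, x⟫_ℂ‖ₑ := by
  rw [← ofReal_norm, norm_inner_symm, ofReal_norm]

/-- Expanding in the orthonormal basis and exchanging the sums moves `A` to its adjoint. The result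
no longer involves `e`, so every Parseval system, orthonormal or not, computes the same
Hilbert–Schmidt norm. -/
theorem SatisfiesParseval.tsum_enorm_apply {ι : Type*} {e : ι → L2R} (he : SatisfiesParseval e)
    (A : L2R →L[ℂ] L2R) :
    ∑' i, ‖A (e i)‖ₑ ^ 2 = ∑' b : onbL2R, ‖ContinuousLinearMap.adjoint A b‖ₑ ^ 2 := by
  simp only [enorm_sq_eq_tsum (A _)]
  rw [ENNReal.tsum_comm]
  refine tsum_congr fun b => ?_
  rw [← he]
  refine tsum_congr fun i => ?_
  rw [ContinuousLinearMap.adjoint_inner_right, enorm_inner_symm]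

theorem SatisfiesParseval.tsum_enorm_apply_eq_hsNormSq {ι : Type*} {e : ι → L2R}
    (he : SatisfiesParseval e) (A : L2R →L[ℂ] L2R) : ∑' i, ‖A (e i)‖ₑ ^ 2 = hsNormSq A := by
  rw [he.tsum_enorm_apply, ← satisfiesParseval_onbL2R.tsum_enorm_apply, hsNormSq]

theorem SatisfiesParseval.schrodinger {ι : Type*} {e : ι → L2R} (he : SatisfiesParseval e)
    (l : ℝ) (n : Heis) : SatisfiesParseval fun i => schrodinger l n (e i) := by
  intro x
  simp only [inner_schrodinger_left]
  rw [he, ← ofReal_norm, ← schrodingerIsometry_apply, LinearIsometry.norm_map, ofReal_norm]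

/-- The operator `π_l(u) A π_l(v)⁻¹`. -/
noncomputable def conjOp (w : Heis × Heis) (l : ℝ) (A : L2R →L[ℂ] L2R) : L2R →L[ℂ] L2R :=
  (schrodingerIsometry l w.1).toContinuousLinearMap ∘L A ∘L
    (schrodingerIsometry l w.2⁻¹).toContinuousLinearMap

theorem conjOp_apply (w : Heis × Heis) (l : ℝ) (A : L2R →L[ℂ] L2R) (φ : L2R) :
    conjOp w l A φ = schrodinger l w.1 (A (schrodinger l w.2⁻¹ φ)) := rfl

theorem conjOp_sub (w : Heis × Heis) (l : ℝ) (A B : L2R →L[ℂ] L2R) :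
    conjOp w l A - conjOp w l B = conjOp w l (A - B) := by
  simp [conjOp]

theorem hsNormSq_conjOp (w : Heis × Heis) (l : ℝ) (A : L2R →L[ℂ] L2R) :
    hsNormSq (conjOp w l A) = hsNormSq A := by
  rw [← (satisfiesParseval_onbL2R.schrodinger l w.2⁻¹).tsum_enorm_apply_eq_hsNormSq A, hsNormSq]
  refine tsum_congr fun e => ?_
  rw [conjOp_apply, ← ofReal_norm, ← schrodingerIsometry_apply l w.1, LinearIsometry.norm_map,
    ofReal_norm]

theorem conjOp_rankOne (w : Heis × Heis) (l : ℝ) (u v : L2R) :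
    conjOp w l (InnerProductSpace.rankOne ℂ u v) =
      InnerProductSpace.rankOne ℂ (schrodinger l w.1 u) (schrodinger l w.2 v) := by
  ext1 φ
  rw [conjOp_apply, InnerProductSpace.rankOne_apply, InnerProductSpace.rankOne_apply,
    ← schrodingerIsometry_apply l w.1, map_smul, inner_schrodinger_left,
    schrodingerIsometry_apply]

/-- The inner product is a limit of finite partial sums over the countable basis, so weak
measurability of both fields suffices. -/
theorem aemeasurable_inner_of_forall {a b : ℝ → L2R}
    (ha : ∀ ψ : L2R, AEMeasurable (fun l => ⟪ψ, a l⟫_ℂ) volume)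
    (hb : ∀ ψ : L2R, AEMeasurable (fun l => ⟪ψ, b l⟫_ℂ) volume) :
    AEMeasurable (fun l => ⟪b l, a l⟫_ℂ) volume := by
  have : Countable onbL2R := countable_onbL2R.to_subtype
  refine aemeasurable_of_tendsto_metrizable_ae (atTop : Filter (Finset onbL2R))
    (f := fun (s : Finset onbL2R) l => ∑ e ∈ s, ⟪b l, (e : L2R)⟫_ℂ * ⟪(e : L2R), a l⟫_ℂ)
    (fun s => ?_)
    (ae_of_all _ fun l => hasSum_inner_mul_inner_onbL2R (b l) (a l))
  refine Finset.aemeasurable_fun_sum s fun e _ => AEMeasurable.mul ?_ (ha e)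
  have h := continuous_star.measurable.comp_aemeasurable (hb e)
  refine h.congr (ae_of_all _ fun l => ?_)
  exact inner_conj_symm _ _

theorem aemeasurable_inner_apply {T : ℝ → L2R →L[ℂ] L2R} {a b : ℝ → L2R}
    (hT : ∀ φ ψ : L2R, AEMeasurable (fun l => ⟪ψ, T l φ⟫_ℂ) volume)
    (ha : ∀ ψ : L2R, AEMeasurable (fun l => ⟪ψ, a l⟫_ℂ) volume)
    (hb : ∀ ψ : L2R, AEMeasurable (fun l => ⟪ψ, b l⟫_ℂ) volume) :
    AEMeasurable (fun l => ⟪b l, T l (a l)⟫_ℂ) volume := by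
  refine aemeasurable_inner_of_forall (fun ψ => ?_) hb
  -- With `ψ` fixed, `T l` passes to its adjoint, so that again only two vector fields are paired.
  have h := aemeasurable_inner_of_forall (a := a)
    (b := fun l => ContinuousLinearMap.adjoint (T l) ψ) ha fun φ => ?_
  · simpa only [ContinuousLinearMap.adjoint_inner_left] using h
  · have h := continuous_star.measurable.comp_aemeasurable (hT φ ψ)
    refine h.congr (ae_of_all _ fun l => ?_)
    simp only [Function.comp]
    rw [ContinuousLinearMap.adjoint_inner_right]
    exact inner_conj_symm _ _

theorem IsL2Field.conjOp {T : ℝ → L2R →L[ℂ] L2R} (hT : IsL2Field T) (w : Heis × Heis) :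
    IsL2Field fun l => conjOp w l (T l) := by
  refine ⟨fun φ ψ => ?_, by simpa only [hsNormSq_conjOp] using hT.2⟩
  simp only [conjOp_apply, inner_schrodinger_right]
  exact aemeasurable_inner_apply hT.1
    (fun χ => (measurable_inner_schrodinger _ _ _).aemeasurable)
    (fun χ => (measurable_inner_schrodinger _ _ _).aemeasurable)

/-! ### Covariance of the Plancherel transform -/

theorem coeFn_tau (w : Heis × Heis) (f : L2H) :
    tau w f =ᵐ[volume] fun n => f (w.1⁻¹ * n * w.2) := by
  have h1 := Lp.coeFn_compMeasurePreserving (rightTranslation w.2 f)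
    (Heis.measurePreserving_mul_left w.1⁻¹)
  have h2 := (Heis.measurePreserving_mul_left w.1⁻¹).quasiMeasurePreserving.ae
    (Lp.coeFn_compMeasurePreserving f (Heis.measurePreserving_mul_right w.2))
  filter_upwards [h1, h2] with n e1 e2
  exact e1.trans e2

theorem isometry_tau (w : Heis × Heis) : Isometry (tau w) :=
  (Lp.isometry_compMeasurePreserving (Heis.measurePreserving_mul_left w.1⁻¹)).comp
    (Lp.isometry_compMeasurePreserving (Heis.measurePreserving_mul_right w.2))

theorem measurePreserving_biregular (w : Heis × Heis) :
    MeasurePreserving (fun n : Heis => w.1⁻¹ * n * w.2) volume volume :=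
  (Heis.measurePreserving_mul_right w.2).comp (Heis.measurePreserving_mul_left w.1⁻¹)

theorem integrable_tau (w : Heis × Heis) {g : L2H} (hg : Integrable g volume) :
    Integrable (tau w g) volume :=
  ((measurePreserving_biregular w).integrable_comp_of_integrable hg).congr (coeFn_tau w g).symm

/-- Substituting `n = u m v⁻¹`, which preserves the measure, in `∫ g(u⁻¹ n v) π(n) dn` gives `π(u)
(∫ g(m) π(m) dm) π(v)⁻¹`. -/
theorem IsGroupFourier.tau (w : Heis × Heis) {g : L2H} (hg : Integrable g volume) {l : ℝ}
    {T : L2R →L[ℂ] L2R} (hT : IsGroupFourier g l T) :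
    IsGroupFourier (tau w g) l (conjOp w l T) := by
  intro φ ψ
  have hmp := measurePreserving_biregular w
  have hi := integrable_mul_inner_schrodinger hg l (schrodinger l w.2⁻¹ φ) (schrodinger l w.1⁻¹ ψ)
  have h := integral_map hmp.measurable.aemeasurable (f := fun n => g n *
    ⟪schrodinger l w.1⁻¹ ψ, schrodinger l n (schrodinger l w.2⁻¹ φ)⟫_ℂ)
    (by rw [hmp.map_eq]; exact hi.1)
  rw [hmp.map_eq] at h
  rw [conjOp_apply, inner_schrodinger_right, hT, h]
  refine integral_congr_ae ?_
  filter_upwards [coeFn_tau w g] with n hn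
  rw [hn, ← inner_schrodinger_right, ← schrodinger_mul, ← schrodinger_mul]
  congr 4
  group

theorem IsPlancherelTransform.tau (w : Heis × Heis) {f : L2H} {T : ℝ → L2R →L[ℂ] L2R}
    (h : IsPlancherelTransform f T) :
    IsPlancherelTransform (tau w f) fun l => conjOp w l (T l) := by
  obtain ⟨hT, g, G, hi, hF, hG, hg, hlim⟩ := h
  refine ⟨hT.conjOp w, fun k => HeisenbergFrames.tau w (g k), fun k l => conjOp w l (G k l),
    fun k => integrable_tau w (hi k), fun k l hl => (hF k l hl).tau w (hi k),
    fun k => (hG k).conjOp w, ((isometry_tau w).continuous.tendsto f).comp hg, ?_⟩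
  simpa only [conjOp_sub, hsNormSq_conjOp] using hlim

/-! ### Functions with a prescribed Plancherel transform -/

theorem tendsto_zero_of_sq_tendsto_zero {ι : Type*} {F : Filter ι} {a : ι → ℝ≥0∞}
    (h : Tendsto (fun i => a i ^ 2) F (𝓝 0)) : Tendsto a F (𝓝 0) := by
  have h1 := ((ENNReal.continuous_rpow_const (y := 1 / 2)).tendsto 0).comp h
  rw [ENNReal.zero_rpow_of_pos (by norm_num)] at h1
  refine h1.congr fun i => ?_
  rw [Function.comp, ← ENNReal.rpow_natCast, ← ENNReal.rpow_mul]
  norm_num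

/-- If `g k` are integrable functions in `L²(ℍ)` converging to the inverse partial Fourier
transform of `M`, then the latter has the field of operators with kernels given by `M` as its
Plancherel transform. -/
theorem isPlancherelTransform_of_tendsto {M : ℝ → ℝ × ℝ → ℂ}
    (hMm : Measurable fun r : ℝ × (ℝ × ℝ) => M r.1 r.2)
    (hM1 : ∀ x, Integrable (M x)) (hM2 : ∀ x, MemLp (M x) 2 volume)
    (hM3 : ∫⁻ x : ℝ, ∫⁻ q, ‖M x q‖ₑ ^ 2 < ∞) {T : ℝ → L2R →L[ℂ] L2R}
    (hT : ∀ᵐ l : ℝ, HasKernel (T l) fun t s => M (t - s) (l * t, l))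
    {f : L2H} (hf : f =ᵐ[volume] partialFourierInv M) {g : ℕ → L2H}
    (hg : ∀ k, Integrable (g k) volume) (hlim : Tendsto g atTop (𝓝 f)) :
    IsPlancherelTransform f T := by
  choose G hG using fun k l => exists_isGroupFourier (hg k) l
  refine ⟨isL2Field_of_hasKernel hMm hM3 hT, g, G, hg, fun k l _ => hG k l,
    fun k => isL2Field_groupFourier (hg k) fun l _ => hG k l, hlim, ?_⟩
  -- Here `f` need not be integrable; the difference form of Plancherel's formula makes the distance
  -- of the fields equal to that of `g k` and `f`.
  have key : ∀ k, ∫⁻ l, hsNormSq (G k l - T l) ∂plancherelMeasure = ‖g k - f‖ₑ ^ 2 := by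
    intro k
    have hm := (Lp.stronglyMeasurable (g k)).measurable
    have hKm := (stronglyMeasurable_partialFourier hm).measurable
    have hK := lintegral_partialFourier hm (hg k) (lintegral_enorm_sq_lt_top (g k))
    have hfin : ∫⁻ x : ℝ, ∫⁻ q, ‖partialFourier (g k) x q‖ₑ ^ 2 < ∞ :=
      hK ▸ lintegral_enorm_sq_lt_top (g k)
    have hsub := lintegral_partialFourier_sub hm (hg k) (lintegral_enorm_sq_lt_top (g k))
      hMm hM1 hM2
    have e : ∫⁻ n, ‖g k n - partialFourierInv M n‖ₑ ^ 2 = ‖g k - f‖ₑ ^ 2 := by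
      rw [enorm_sq_eq_lintegral]
      refine lintegral_congr_ae ?_
      filter_upwards [hf, Lp.coeFn_sub (g k) f] with n h1 h2
      rw [h2, Pi.sub_apply, h1]
    rw [← e, ← hsub]
    refine lintegral_hsNormSq_of_hasKernel
      (K := fun x q => partialFourier (g k) x q - M x q) (hKm.sub hMm) ?_ ?_
    · rw [hsub, e]; finiteness
    · filter_upwards [hT, hasKernel_groupFourier (hg k) fun l _ => hG k l,
        ae_memLp_kernel hKm hfin, ae_memLp_kernel hMm hM3] with l h1 h2 h3 h4
      exact h2.sub h1 h3 h4
  simp only [key]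
  have h0 : Tendsto (fun k => ‖g k - f‖ₑ) atTop (𝓝 0) := by
    have h1 : Tendsto (fun k => g k - f) atTop (𝓝 (f - f)) := hlim.sub_const f
    rw [sub_self] at h1
    simpa [Function.comp_def] using (continuous_enorm.tendsto (0 : L2H)).comp h1
  simpa [Function.comp_def] using ((ENNReal.continuous_pow 2).tendsto 0).comp h0

/-- The box `[-a, a] × [-b, b] × [-c, c]` in the Heisenberg group. -/
def box (a b c : ℝ) : Set Heis := {n | n.x ∈ Icc (-a) a ∧ n.y ∈ Icc (-b) b ∧ n.z ∈ Icc (-c) c}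

theorem measurableSet_box (a b c : ℝ) : MeasurableSet (box a b c) :=
  measurableSet_Icc.prod (measurableSet_Icc.prod measurableSet_Icc)

theorem volume_box_lt_top (a b c : ℝ) : volume (box a b c) < ∞ := by
  change (volume : Measure (ℝ × ℝ × ℝ)) (Icc (-a) a ×ˢ (Icc (-b) b ×ˢ Icc (-c) c)) < ∞
  rw [Measure.volume_eq_prod, Measure.prod_prod, Measure.volume_eq_prod, Measure.prod_prod]
  exact ENNReal.mul_lt_top measure_Icc_lt_top
    (ENNReal.mul_lt_top measure_Icc_lt_top measure_Icc_lt_top)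

/-- The inverse partial transform `f₀` of a bounded, compactly supported symbol is bounded, square
integrable and supported in `|x| ≤ R`, but it may fail to be integrable in `(y, z)`. Its cutoffs to
the boxes `box R k k` are integrable and tend to it in `L²` by dominated convergence. -/
theorem exists_isPlancherelTransform {M : ℝ → ℝ × ℝ → ℂ}
    (hMm : Measurable fun r : ℝ × (ℝ × ℝ) => M r.1 r.2) {R C : ℝ}
    (hC : ∀ x q, ‖M x q‖ ≤ C)
    (hR : ∀ x q, M x q ≠ 0 → x ∈ Icc (-R) R ∧ q ∈ Icc (-R) R ×ˢ Icc (-R) R)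
    {T : ℝ → L2R →L[ℂ] L2R}
    (hT : ∀ᵐ l : ℝ, HasKernel (T l) fun t s => M (t - s) (l * t, l)) :
    ∃ f : L2H, IsPlancherelTransform f T := by
  set B : Set (ℝ × ℝ) := Icc (-R) R ×ˢ Icc (-R) R with hB
  have hBm : MeasurableSet B := measurableSet_Icc.prod measurableSet_Icc
  have hBv : volume B < ∞ := by
    rw [hB, Measure.volume_eq_prod, Measure.prod_prod]
    exact ENNReal.mul_lt_top measure_Icc_lt_top measure_Icc_lt_top
  have hMx : ∀ x, AEStronglyMeasurable (M x) volume := fun x =>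
    (hMm.comp (measurable_const.prodMk measurable_id)).aestronglyMeasurable
  have hle : ∀ x q, ‖M x q‖ ≤ ‖B.indicator (fun _ => C) q‖ := by
    intro x q
    by_cases h : q ∈ B
    · rw [indicator_of_mem h]
      exact (hC x q).trans (le_abs_self C)
    · have : M x q = 0 := by
        by_contra h'
        exact h (hR x q h').2
      rw [this, norm_zero]
      exact norm_nonneg _
  have hBp : ∀ p, MemLp (B.indicator fun _ => C) p volume := fun p =>
    memLp_indicator_const p hBm C (Or.inr hBv.ne)
  have hM1 : ∀ x, Integrable (M x) := fun x =>
    memLp_one_iff_integrable.1 ((hBp 1).of_le (hMx x) (ae_of_all _ (hle x)))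
  have hM2 : ∀ x, MemLp (M x) 2 volume := fun x => (hBp 2).of_le (hMx x) (ae_of_all _ (hle x))
  have hM3 : ∫⁻ x : ℝ, ∫⁻ q, ‖M x q‖ₑ ^ 2 < ∞ := by
    have h1 : MemLp (fun n : Heis => M n.x (n.y, n.z)) 2 volume := by
      refine (memLp_indicator_const 2 (measurableSet_box R R R) C
        (Or.inr (volume_box_lt_top R R R).ne)).of_le ?_ (ae_of_all _ fun n => ?_)
      · exact Measurable.aestronglyMeasurable hMm
      · by_cases h : n ∈ box R R R
        · rw [indicator_of_mem h]
          exact (hC _ _).trans (le_abs_self C)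
        · have : M n.x (n.y, n.z) = 0 := by
            by_contra h'
            have := hR _ _ h'
            exact h ⟨this.1, this.2.1, this.2.2⟩
          rw [this, norm_zero]
          exact norm_nonneg _
    have h2 := (memLp_two_iff_lintegral h1.1).1 h1
    rw [lintegral_heis (φ := fun n => ‖M n.x (n.y, n.z)‖ₑ ^ 2) (hMm.enorm.pow_const 2)] at h2
    exact h2
  set f₀ := partialFourierInv M with hf₀
  have hf₀m : StronglyMeasurable f₀ := stronglyMeasurable_partialFourierInv hMm
  have hf₀sq : ∫⁻ n, ‖f₀ n‖ₑ ^ 2 < ∞ := by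
    rwa [hf₀, lintegral_partialFourierInv hMm hM1 hM2]
  have hf₀2 : MemLp f₀ 2 volume :=
    (memLp_two_iff_lintegral hf₀m.aestronglyMeasurable).2 hf₀sq
  have hf₀b : ∀ n, ‖f₀ n‖ ≤ ∫ q, ‖B.indicator (fun _ => C) q‖ := by
    intro n
    refine norm_integral_le_of_norm_le (memLp_one_iff_integrable.1 (hBp 1)).norm
      (ae_of_all _ fun q => ?_)
    rw [norm_mul, Complex.norm_exp_ofReal_mul_I, one_mul]
    exact hle _ q
  have hf₀x : ∀ n : Heis, n.x ∉ Icc (-R) R → f₀ n = 0 := by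
    intro n hn
    have : ∀ q, M n.x q = 0 := by
      intro q
      by_contra h'
      exact hn (hR _ _ h').1
    simp [hf₀, partialFourierInv, planeFourierInv, this]
  have hgm : ∀ k : ℕ, MemLp ((box R k k).indicator f₀) 2 volume := fun k =>
    hf₀2.indicator (measurableSet_box _ _ _)
  have hpt : ∀ n, Tendsto (fun k : ℕ => ‖(box R k k).indicator f₀ n - f₀ n‖ₑ ^ 2) atTop (𝓝 0) := by
    intro n
    refine tendsto_const_nhds.congr' ?_
    by_cases hx : n.x ∈ Icc (-R) R
    · obtain ⟨K, hK⟩ := exists_nat_ge (max |n.y| |n.z|)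
      filter_upwards [eventually_ge_atTop K] with k hk
      have hk' : max |n.y| |n.z| ≤ (k : ℝ) := hK.trans (by exact_mod_cast hk)
      have : n ∈ box R k k :=
        ⟨hx, abs_le.1 ((le_max_left _ _).trans hk'), abs_le.1 ((le_max_right _ _).trans hk')⟩
      rw [indicator_of_mem this]
      simp
    · refine Eventually.of_forall fun k => ?_
      have : n ∉ box R k k := fun h => hx h.1
      simp [indicator_of_notMem this, hf₀x n hx]
  have hlim : Tendsto (fun k : ℕ => ∫⁻ n, ‖(box R k k).indicator f₀ n - f₀ n‖ₑ ^ 2) atTop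
      (𝓝 0) := by
    have h := tendsto_lintegral_of_dominated_convergence (μ := (volume : Measure Heis))
      (F := fun (k : ℕ) n => ‖(box R k k).indicator f₀ n - f₀ n‖ₑ ^ 2) (f := fun _ => 0)
      (fun n => ‖f₀ n‖ₑ ^ 2)
      (fun k => ((hf₀m.measurable.indicator (measurableSet_box _ _ _)).sub
        hf₀m.measurable).enorm.pow_const 2)
      (fun k => ae_of_all _ fun n => ?_) hf₀sq.ne (ae_of_all _ hpt)
    · simpa using h
    · by_cases h : n ∈ box R k k
      · simp [indicator_of_mem h]
      · simp [indicator_of_notMem h]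
  refine ⟨hf₀2.toLp f₀, isPlancherelTransform_of_tendsto hMm hM1 hM2 hM3 hT hf₀2.coeFn_toLp
    (g := fun k => (hgm k).toLp _) (fun k => ?_) ?_⟩
  · refine Integrable.congr ?_ (hgm k).coeFn_toLp.symm
    rw [integrable_indicator_iff (measurableSet_box _ _ _)]
    exact Measure.integrableOn_of_bounded (volume_box_lt_top _ _ _).ne
      hf₀m.aestronglyMeasurable (ae_of_all _ hf₀b)
  · rw [tendsto_iff_edist_tendsto_0]
    refine tendsto_zero_of_sq_tendsto_zero (hlim.congr fun k => ?_)
    rw [edist_eq_enorm_sub, enorm_sq_eq_lintegral]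
    refine lintegral_congr_ae ?_
    filter_upwards [(hgm k).coeFn_toLp, hf₀2.coeFn_toLp,
      Lp.coeFn_sub ((hgm k).toLp _) (hf₀2.toLp f₀)] with n h1 h2 h3
    rw [h3, Pi.sub_apply, h1, h2]

/-! ### Parseval's identity for Fourier series -/

theorem tsum_enorm_sq_eq_of_hasSum {ι E : Type*} [NormedAddCommGroup E] {a : ι → E} {r : ℝ}
    (h : HasSum (fun i => ‖a i‖ ^ 2) r) : ∑' i, ‖a i‖ₑ ^ 2 = ENNReal.ofReal r := by
  rw [← h.tsum_eq, ENNReal.ofReal_tsum_of_nonneg (fun _ => by positivity) h.summable]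
  refine tsum_congr fun i => ?_
  rw [ENNReal.ofReal_pow (norm_nonneg _), ofReal_norm]

theorem hasSum_of_tsum_enorm_sq_eq {ι E E' : Type*} [NormedAddCommGroup E]
    [NormedAddCommGroup E'] {a : ι → E} {x : E'} (h : ∑' i, ‖a i‖ₑ ^ 2 = ‖x‖ₑ ^ 2) :
    HasSum (fun i => ‖a i‖ ^ 2) (‖x‖ ^ 2) := by
  have h1 := ENNReal.hasSum_toReal (f := fun i => ‖a i‖ₑ ^ 2) (by rw [h]; finiteness)
  rw [← ENNReal.tsum_toReal_eq fun i => by finiteness, h] at h1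
  simpa only [ENNReal.toReal_pow, toReal_enorm] using h1

theorem ofReal_integral_norm_sq {α : Type*} [MeasurableSpace α] {μ : Measure α} {F : α → ℂ}
    (hF : MemLp F 2 μ) : ENNReal.ofReal (∫ t, ‖F t‖ ^ 2 ∂μ) = ∫⁻ t, ‖F t‖ₑ ^ 2 ∂μ := by
  rw [ofReal_integral_eq_lintegral_ofReal hF.norm.integrable_sq
    (ae_of_all _ fun t => by positivity)]
  refine lintegral_congr fun t => ?_
  rw [ENNReal.ofReal_pow (norm_nonneg _), ofReal_norm]

/-- Fourier coefficients carry a factor `1/T` and Parseval's identity a mean over the period;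
without normalization the constant is `T² · 1/T = T`. -/
theorem tsum_enorm_fourier_integral {a T : ℝ} (hT : 0 < T) {F : ℝ → ℂ}
    (hF : MemLp F 2 (volume.restrict (Ioc a (a + T)))) :
    ∑' m : ℤ, ‖∫ t in Ioc a (a + T),
      Complex.exp ((-(2 * Real.pi * m * t / T) : ℝ) * Complex.I) * F t‖ₑ ^ 2 =
      ENNReal.ofReal T * ∫⁻ t in Ioc a (a + T), ‖F t‖ₑ ^ 2 := by
  have hab : a < a + T := by linarith
  have h := hasSum_sq_fourierCoeffOn hab hF
  rw [intervalIntegral.integral_of_le hab.le] at h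
  have e : ∀ m : ℤ, fourierCoeffOn hab F m = ((1 / T : ℝ) : ℂ) * ∫ t in Ioc a (a + T),
      Complex.exp ((-(2 * Real.pi * m * t / T) : ℝ) * Complex.I) * F t := by
    intro m
    rw [fourierCoeffOn_eq_integral, intervalIntegral.integral_of_le hab.le, Complex.real_smul,
      add_sub_cancel_left]
    congr 1
    refine integral_congr_ae (ae_of_all _ fun t => ?_)
    simp only [fourier_coe_apply, smul_eq_mul]
    congr 2
    push_cast
    ring
  simp only [e, norm_mul, mul_pow, add_sub_cancel_left] at h
  have h2 := h.mul_left (T ^ 2)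
  have e2 : ∀ m : ℤ, T ^ 2 * (‖((1 / T : ℝ) : ℂ)‖ ^ 2 * ‖∫ t in Ioc a (a + T),
      Complex.exp ((-(2 * Real.pi * m * t / T) : ℝ) * Complex.I) * F t‖ ^ 2) =
      ‖∫ t in Ioc a (a + T),
      Complex.exp ((-(2 * Real.pi * m * t / T) : ℝ) * Complex.I) * F t‖ ^ 2 := by
    intro m
    rw [Complex.norm_real, Real.norm_of_nonneg (by positivity), ← mul_assoc, ← mul_pow,
      mul_one_div_cancel hT.ne', one_pow, one_mul]
  simp only [e2] at h2
  rw [tsum_enorm_sq_eq_of_hasSum h2, ← ofReal_integral_norm_sq hF, ← ENNReal.ofReal_mul hT.le]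
  congr 1
  rw [smul_eq_mul]
  field_simp

/-! ### The Gabor systems of the indicator function of the unit interval -/

/-- The indicator function of `(0, 1]`. -/
noncomputable def unitIndicator : L2R :=
  indicatorConstLp 2 (measurableSet_Ioc (a := (0 : ℝ)) (b := 1)) measure_Ioc_lt_top.ne (1 : ℂ)

theorem coeFn_unitIndicator :
    unitIndicator =ᵐ[volume] (Ioc (0 : ℝ) 1).indicator fun _ => (1 : ℂ) :=
  indicatorConstLp_coeFn

theorem inner_unitIndicator (φ : L2R) : ⟪unitIndicator, φ⟫_ℂ = ∫ t in Ioc (0 : ℝ) 1, φ t :=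
  L2.inner_indicatorConstLp_one _ _ _

theorem star_smul_unitIndicator (r : ℝ) :
    star ((r : ℂ) • unitIndicator) = (r : ℂ) • unitIndicator := by
  refine Lp.ext ?_
  filter_upwards [Lp.coeFn_star ((r : ℂ) • unitIndicator), Lp.coeFn_smul (r : ℂ) unitIndicator,
    coeFn_unitIndicator] with t h1 h2 h3
  rw [h1, Pi.star_apply, h2, Pi.smul_apply, h3]
  by_cases h : t ∈ Ioc (0 : ℝ) 1 <;> simp [h]

theorem enorm_unitIndicator : ‖unitIndicator‖ₑ = 1 := by
  rw [← ofReal_norm, unitIndicator, norm_indicatorConstLp (by norm_num) (by norm_num)]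
  simp

theorem inner_gaborSystem_unitIndicator (l : ℝ) (m n : ℤ) (φ : L2R) :
    ⟪gaborSystem 1 l unitIndicator (m, n), φ⟫_ℂ = ∫ t in Ioc (n : ℝ) (n + 1),
      Complex.exp ((-(2 * Real.pi * (l * m) * t) : ℝ) * Complex.I) * φ t := by
  rw [L2.inner_def, ← integral_indicator measurableSet_Ioc]
  refine integral_congr_ae ?_
  filter_upwards [coeFn_phaseTranslate (fun t => 2 * Real.pi * (l * m) * t) (by fun_prop)
    (1 * n) unitIndicator, ae_comp_sub coeFn_unitIndicator (1 * n)] with t h1 h2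
  rw [gaborSystem, h1, h2, RCLike.inner_apply]
  by_cases h : t ∈ Ioc (n : ℝ) (n + 1)
  · have h' : t - 1 * n ∈ Ioc (0 : ℝ) 1 := ⟨by linarith [h.1], by linarith [h.2]⟩
    rw [indicator_of_mem h, indicator_of_mem h', mul_one, ← Complex.exp_conj, mul_comm, map_mul,
      Complex.conj_ofReal, Complex.conj_I]
    congr 2
    push_cast
    ring
  · have h' : t - 1 * n ∉ Ioc (0 : ℝ) 1 := fun h' => h ⟨by linarith [h'.1], by linarith [h'.2]⟩
    rw [indicator_of_notMem h, indicator_of_notMem h']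
    simp

/-- The function `φ`, cut off to `(n, n+1]`, is expanded on the longer interval `(n, n + 1/|l|]`,
whose Fourier frequencies are the multiples of `|l|`. The assumption `|l| ≤ 1` makes the unit
interval fit. -/
theorem tsum_gaborSystem_unitIndicator {l : ℝ} (hl : l ≠ 0) (hl1 : |l| ≤ 1) (n : ℤ) (φ : L2R) :
    ∑' m : ℤ, ‖⟪gaborSystem 1 l unitIndicator (m, n), φ⟫_ℂ‖ₑ ^ 2 =
      ENNReal.ofReal |l|⁻¹ * ∫⁻ t in Ioc (n : ℝ) (n + 1), ‖φ t‖ₑ ^ 2 := by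
  have hl0 : 0 < |l| := abs_pos.2 hl
  have hT : 0 < |l|⁻¹ := inv_pos.2 hl0
  have hT1 : 1 ≤ |l|⁻¹ := (one_le_inv₀ hl0).2 hl1
  have hsub : Ioc (n : ℝ) (n + 1) ⊆ Ioc (n : ℝ) (n + |l|⁻¹) :=
    Ioc_subset_Ioc_right (by linarith)
  have hF : MemLp ((Ioc (n : ℝ) (n + 1)).indicator φ) 2
      (volume.restrict (Ioc (n : ℝ) (n + |l|⁻¹))) :=
    ((Lp.memLp φ).indicator measurableSet_Ioc).restrict _
  have h := tsum_enorm_fourier_integral hT hF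
  have e1 : ∫⁻ t in Ioc (n : ℝ) (n + |l|⁻¹), ‖(Ioc (n : ℝ) (n + 1)).indicator φ t‖ₑ ^ 2 =
      ∫⁻ t in Ioc (n : ℝ) (n + 1), ‖φ t‖ₑ ^ 2 := by
    have : ∀ t, ‖(Ioc (n : ℝ) (n + 1)).indicator φ t‖ₑ ^ 2 =
        (Ioc (n : ℝ) (n + 1)).indicator (fun t => ‖φ t‖ₑ ^ 2) t := by
      intro t
      by_cases h : t ∈ Ioc (n : ℝ) (n + 1)
      · rw [indicator_of_mem h, indicator_of_mem h]
      · rw [indicator_of_notMem h, indicator_of_notMem h]; simp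
    simp only [this]
    rw [setLIntegral_indicator measurableSet_Ioc, inter_eq_left.2 hsub]
  have e2 : ∀ m : ℤ, ∫ t in Ioc (n : ℝ) (n + |l|⁻¹),
      Complex.exp ((-(2 * Real.pi * m * t / |l|⁻¹) : ℝ) * Complex.I) *
        (Ioc (n : ℝ) (n + 1)).indicator φ t =
      ∫ t in Ioc (n : ℝ) (n + 1),
        Complex.exp ((-(2 * Real.pi * (|l| * m) * t) : ℝ) * Complex.I) * φ t := by
    intro m
    have : ∀ t, Complex.exp ((-(2 * Real.pi * m * t / |l|⁻¹) : ℝ) * Complex.I) *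
        (Ioc (n : ℝ) (n + 1)).indicator φ t = (Ioc (n : ℝ) (n + 1)).indicator (fun t =>
          Complex.exp ((-(2 * Real.pi * (|l| * m) * t) : ℝ) * Complex.I) * φ t) t := by
      intro t
      by_cases h : t ∈ Ioc (n : ℝ) (n + 1)
      · rw [indicator_of_mem h, indicator_of_mem h, div_inv_eq_mul]
        congr 4
        ring
      · rw [indicator_of_notMem h, indicator_of_notMem h, mul_zero]
    simp only [this]
    rw [setIntegral_indicator measurableSet_Ioc, inter_eq_right.2 hsub]
  rw [e1] at h
  simp only [e2] at h
  rw [← h]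
  simp only [inner_gaborSystem_unitIndicator]
  rcases abs_choice l with hl2 | hl2
  · rw [hl2]
  -- For negative `l` the frequencies are the same after `m ↦ -m`.
  · rw [hl2, ← (Equiv.neg ℤ).tsum_eq]
    refine tsum_congr fun m => ?_
    simp

theorem gaborSystem_smul (a b : ℝ) (c : ℂ) (g : L2R) (mn : ℤ × ℤ) :
    gaborSystem a b (c • g) mn = c • gaborSystem a b g mn :=
  phaseTranslate_smul _ _ _ _ _

theorem tsum_lintegral_Ioc_int (F : ℝ → ℝ≥0∞) :
    ∑' n : ℤ, ∫⁻ t in Ioc (n : ℝ) (n + 1), F t = ∫⁻ t, F t := by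
  rw [← lintegral_iUnion (fun n => measurableSet_Ioc) (pairwise_disjoint_Ioc_intCast ℝ),
    iUnion_Ioc_intCast, setLIntegral_univ]

/-- The squared factor `|l|` cancels the bound `1/|l|` on each unit interval, and these intervals
tile the line. -/
theorem satisfiesParseval_gaborSystem {l : ℝ} (hl : l ≠ 0) (hl1 : |l| ≤ 1) :
    SatisfiesParseval (gaborSystem 1 l (((|l| ^ (1 / 2 : ℝ) : ℝ) : ℂ) • unitIndicator)) := by
  intro φ
  have hl0 : 0 < |l| := abs_pos.2 hl
  have hc : ‖((|l| ^ (1 / 2 : ℝ) : ℝ) : ℂ)‖ₑ ^ 2 = ENNReal.ofReal |l| := by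
    rw [← ofReal_norm, Complex.norm_real, Real.norm_of_nonneg (by positivity),
      ← ENNReal.ofReal_pow (by positivity), ← Real.rpow_natCast, ← Real.rpow_mul hl0.le]
    norm_num
  have e : ∀ mn : ℤ × ℤ, ‖⟪gaborSystem 1 l (((|l| ^ (1 / 2 : ℝ) : ℝ) : ℂ) • unitIndicator) mn,
      φ⟫_ℂ‖ₑ ^ 2 = ENNReal.ofReal |l| * ‖⟪gaborSystem 1 l unitIndicator mn, φ⟫_ℂ‖ₑ ^ 2 := by
    intro mn
    rw [gaborSystem_smul, inner_smul_left, enorm_mul, mul_pow, Complex.conj_ofReal, hc]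
  simp only [e]
  rw [ENNReal.tsum_mul_left, ENNReal.tsum_prod', ENNReal.tsum_comm]
  simp only [tsum_gaborSystem_unitIndicator hl hl1]
  rw [ENNReal.tsum_mul_left, ← mul_assoc, ← ENNReal.ofReal_mul hl0.le, mul_inv_cancel₀ hl0.ne',
    ENNReal.ofReal_one, one_mul, tsum_lintegral_Ioc_int, enorm_sq_eq_lintegral]

theorem SatisfiesParseval.isParsevalFrame {ι : Type*} {e : ι → L2R} (he : SatisfiesParseval e) :
    IsParsevalFrame ⊤ e :=
  ⟨fun _ => Submodule.mem_top, fun x _ => hasSum_of_tsum_enorm_sq_eq (he x)⟩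

theorem gaborSystem_eq_schrodinger (l : ℝ) (g : L2R) (m n : ℤ) :
    gaborSystem 1 l g (m, n) = schrodinger l (Heis.mk n (-m) 0) g := by
  refine Lp.ext ?_
  rw [gaborSystem, schrodinger]
  filter_upwards [coeFn_phaseTranslate (fun t => 2 * Real.pi * (l * m) * t) (by fun_prop)
    (1 * n) g, coeFn_phaseTranslate (fun t => 2 * Real.pi * l * (Heis.mk n (-m) 0).z -
      2 * Real.pi * l * (Heis.mk n (-m) 0).y * t) (by fun_prop) (Heis.mk n (-m) 0).x g]
    with t h1 h2
  rw [h1, h2, Heis.x_mk, Heis.y_mk, Heis.z_mk, one_mul]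
  congr 4
  ring

/-! ### Fourier series on a set whose integer translates are disjoint -/

/-- Integer frequencies see only the periodization `Φ r + Φ (r - 1)` on `(0, 1]`. At almost every
`r` one summand vanishes, so there is no cross term and Parseval's identity on the unit interval
returns the full norm. -/
theorem tsum_enorm_fourier_integral_of_disjoint {Φ : ℝ → ℂ} (hΦ : MemLp Φ 2 volume)
    (hsupp : ∀ l, l ∉ Ioc (-1 : ℝ) 1 → Φ l = 0)
    (hdisj : ∀ᵐ r : ℝ, r ∈ Ioc (0 : ℝ) 1 → Φ r = 0 ∨ Φ (r - 1) = 0) :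
    ∑' k : ℤ, ‖∫ l, Complex.exp ((-(2 * Real.pi * k * l) : ℝ) * Complex.I) * Φ l‖ₑ ^ 2 =
      ∫⁻ l, ‖Φ l‖ₑ ^ 2 := by
  have hU : Ioc (-1 : ℝ) 1 = Ioc (-1 : ℝ) 0 ∪ Ioc 0 1 :=
    (Ioc_union_Ioc_eq_Ioc (by norm_num) (by norm_num)).symm
  have hD : Disjoint (Ioc (-1 : ℝ) 0) (Ioc 0 1) := Ioc_disjoint_Ioc_of_le le_rfl
  have hΦ' : MemLp (fun r => Φ (r - 1)) 2 volume :=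
    hΦ.comp_measurePreserving (measurePreserving_sub_right volume 1)
  have hpre : (fun r : ℝ => r - 1) ⁻¹' Ioc (-1 : ℝ) 0 = Ioc 0 1 := by
    ext r
    simp only [mem_preimage, mem_Ioc]
    constructor <;> rintro ⟨h1, h2⟩ <;> constructor <;> linarith
  have hemb : MeasurableEmbedding fun r : ℝ => r - 1 :=
    (MeasurableEquiv.subRight (1 : ℝ)).measurableEmbedding
  have hfin : IsFiniteMeasure (volume.restrict (Ioc (0 : ℝ) 1)) :=
    ⟨by rw [Measure.restrict_apply_univ]; exact measure_Ioc_lt_top⟩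
  have hfin' : IsFiniteMeasure (volume.restrict (Ioc (-1 : ℝ) 0)) :=
    ⟨by rw [Measure.restrict_apply_univ]; exact measure_Ioc_lt_top⟩
  have hexp : ∀ (k : ℤ) (Ψ : ℝ → ℂ) (μ : Measure ℝ), Integrable Ψ μ → Integrable (fun l =>
      Complex.exp ((-(2 * Real.pi * k * l) : ℝ) * Complex.I) * Ψ l) μ := by
    intro k Ψ μ hΨ
    refine hΨ.bdd_mul (c := 1) ?_ (ae_of_all _ fun l => ?_)
    · exact (by fun_prop : Measurable fun l : ℝ =>
        Complex.exp ((-(2 * Real.pi * k * l) : ℝ) * Complex.I)).aestronglyMeasurable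
    · rw [Complex.norm_exp_ofReal_mul_I]
  have e1 : ∀ k : ℤ, ∫ l, Complex.exp ((-(2 * Real.pi * k * l) : ℝ) * Complex.I) * Φ l =
      ∫ r in Ioc (0 : ℝ) (0 + 1), Complex.exp ((-(2 * Real.pi * k * r / 1) : ℝ) * Complex.I) *
        (Φ r + Φ (r - 1)) := by
    intro k
    rw [← setIntegral_eq_integral_of_forall_compl_eq_zero (s := Ioc (-1 : ℝ) 1)
      (fun l hl => by rw [hsupp l hl, mul_zero]), hU,
      setIntegral_union hD measurableSet_Ioc (hexp k Φ _ ((hΦ.restrict _).integrable (by norm_num)))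
        (hexp k Φ _ ((hΦ.restrict _).integrable (by norm_num))),
      ← (measurePreserving_sub_right volume (1 : ℝ)).setIntegral_preimage_emb hemb, hpre,
      ← integral_add, zero_add]
    · refine integral_congr_ae (ae_of_all _ fun r => ?_)
      have : Complex.exp ((-(2 * Real.pi * k * (r - 1)) : ℝ) * Complex.I) =
          Complex.exp ((-(2 * Real.pi * k * r) : ℝ) * Complex.I) := by
        rw [← mul_one (Complex.exp ((-(2 * Real.pi * k * r) : ℝ) * Complex.I)),
          ← Complex.exp_int_mul_two_pi_mul_I k, ← Complex.exp_add]
        congr 1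
        push_cast
        ring
      simp only [div_one]
      rw [this]
      ring
    · have h := hexp k (fun r => Φ (r - 1)) (volume.restrict (Ioc (0 : ℝ) 1))
        ((hΦ'.restrict _).integrable (by norm_num))
      have h2 := h.const_mul (Complex.exp (((2 * Real.pi * k : ℝ) : ℂ) * Complex.I))
      refine h2.congr (ae_of_all _ fun r => ?_)
      simp only
      rw [← mul_assoc, ← Complex.exp_add]
      congr 2
      push_cast
      ring
    · exact hexp k Φ _ ((hΦ.restrict _).integrable (by norm_num))
  simp only [e1]
  have h0 := tsum_enorm_fourier_integral (a := 0) one_pos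
    (F := fun r => Φ r + Φ (r - 1)) ((hΦ.add hΦ').restrict _)
  rw [h0, ENNReal.ofReal_one, one_mul, zero_add]
  have e2 : ∫⁻ r in Ioc (0 : ℝ) 1, ‖Φ r + Φ (r - 1)‖ₑ ^ 2 =
      ∫⁻ r in Ioc (0 : ℝ) 1, (‖Φ r‖ₑ ^ 2 + ‖Φ (r - 1)‖ₑ ^ 2) := by
    refine setLIntegral_congr_fun_ae measurableSet_Ioc ?_
    filter_upwards [hdisj] with r hr hr'
    rcases hr hr' with h | h <;> simp [h]
  have e3 : ∫⁻ l, ‖Φ l‖ₑ ^ 2 = ∫⁻ l in Ioc (-1 : ℝ) 1, ‖Φ l‖ₑ ^ 2 := by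
    refine (setLIntegral_eq_of_support_subset ?_).symm
    intro l hl
    by_contra h
    simp [hsupp l h] at hl
  refine e2.trans ?_
  rw [lintegral_add_left' (hΦ.1.enorm.pow_const 2).restrict, e3, hU,
    lintegral_union measurableSet_Ioc hD,
    ← (measurePreserving_sub_right volume (1 : ℝ)).setLIntegral_comp_preimage_emb hemb
      (fun l => ‖Φ l‖ₑ ^ 2) (Ioc (-1) 0), hpre, add_comm]

/-- If `r` and `r - 1` both lay in `S`, the congruence would send both to the only point of `r + ℤ`
in `(0, 1]`, namely `r`, against injectivity. -/
theorem TranslationCongruent.ae_not_mem {S : Set ℝ} (h : TranslationCongruent S (Ioc 0 1)) :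
    ∀ᵐ r : ℝ, r ∈ Ioc (0 : ℝ) 1 → ¬ (r ∈ S ∧ r - 1 ∈ S) := by
  obtain ⟨S', J', hS, hJ, k, hmaps, hinj, -⟩ := h
  -- The shifts `k` are arbitrary, not assumed measurable, so the exceptional null sets are
  -- discarded together with all their integer translates.
  have htr : ∀ {p : ℝ → Prop}, (∀ᵐ r, p r) → ∀ᵐ r : ℝ, ∀ n : ℤ, p (r + n) := fun hp =>
    ae_all_iff.2 fun n => (measurePreserving_add_right volume (n : ℝ)).quasiMeasurePreserving.ae hp
  filter_upwards [htr hS.mem_iff, htr hJ.mem_iff] with r h1 h2 hr hS2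
  have hz : ∀ n : ℤ, r + n ∈ Ioc (0 : ℝ) 1 → n = 0 := by
    intro n hn
    have a1 : (n : ℝ) < 1 := by linarith [hr.1, hn.2]
    have a2 : (-1 : ℝ) < n := by linarith [hr.2, hn.1]
    have a3 : n < 1 := by exact_mod_cast a1
    have a4 : -1 < n := by exact_mod_cast a2
    omega
  have m1 : r ∈ S' := by simpa using (h1 0).2 (by simpa using hS2.1)
  have m2 : r - 1 ∈ S' := by
    simpa [sub_eq_add_neg] using (h1 (-1)).2 (by simpa [sub_eq_add_neg] using hS2.2)
  have k1 : k r = 0 := hz _ ((h2 (k r)).1 (hmaps m1))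
  have k2 : k (r - 1) - 1 = 0 := by
    have e : r - 1 + (k (r - 1) : ℝ) = r + ((k (r - 1) - 1 : ℤ) : ℝ) := by push_cast; ring
    have := hmaps m2
    simp only [e] at this
    exact hz _ ((h2 _).1 this)
  have k2' : k (r - 1) = 1 := by omega
  have := hinj m1 m2 (by simp [k1, k2'])
  linarith

/-! ### The field of rank-one operators -/

/-- The window `|l|^{1/4} 1_{(0, 1]}`. -/
noncomputable def window (l : ℝ) : L2R := ((|l| ^ (1 / 4 : ℝ) : ℝ) : ℂ) • unitIndicator

theorem abs_rpow_quarter_mul (l : ℝ) :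
    |l| ^ (1 / 4 : ℝ) * |l| ^ (1 / 4 : ℝ) = |l| ^ (1 / 2 : ℝ) := by
  rw [← Real.rpow_add_of_nonneg (abs_nonneg _) (by norm_num) (by norm_num)]
  norm_num

theorem abs_rpow_half_mul (l : ℝ) : |l| ^ (1 / 2 : ℝ) * |l| ^ (1 / 2 : ℝ) = |l| := by
  rw [← Real.rpow_add_of_nonneg (abs_nonneg _) (by norm_num) (by norm_num)]
  norm_num

theorem smul_window (l : ℝ) : ((|l| ^ (1 / 4 : ℝ) : ℝ) : ℂ) • window l =
    ((|l| ^ (1 / 2 : ℝ) : ℝ) : ℂ) • unitIndicator := by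
  rw [window, smul_smul, ← Complex.ofReal_mul, abs_rpow_quarter_mul]

theorem star_window (l : ℝ) : star (window l) = window l := star_smul_unitIndicator _

theorem enorm_window_sq (l : ℝ) : ‖window l‖ₑ ^ 2 = ENNReal.ofReal (|l| ^ (1 / 2 : ℝ)) := by
  rw [window, enorm_smul, enorm_unitIndicator, mul_one, ← ofReal_norm, Complex.norm_real,
    Real.norm_of_nonneg (by positivity), ← ENNReal.ofReal_pow (by positivity), sq,
    abs_rpow_quarter_mul]

/-- The operators `|l|^{1/2} 1_{(0, 1]} ⊗ 1_{(0, 1]}`, for `l` in `S`. -/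
noncomputable def windowField (S : Set ℝ) (l : ℝ) : L2R →L[ℂ] L2R :=
  InnerProductSpace.rankOne ℂ (S.indicator window l) (window l)

/-- Placing the indicator on the first factor keeps `windowField` of the form `u ⊗ v` at every `l`,
as `IsPlancherelTransform.inner_eq_integral` needs; this links it to the cutoff of the whole field.
-/
theorem windowField_eq_indicator (S : Set ℝ) :
    windowField S = S.indicator fun l => InnerProductSpace.rankOne ℂ (window l) (window l) := by
  funext l
  by_cases h : l ∈ S <;> simp [windowField, h]

theorem windowField_of_notMem {S : Set ℝ} {l : ℝ} (h : l ∉ S) : windowField S l = 0 := by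
  simp [windowField, h]

theorem hsNormSq_windowField (S : Set ℝ) (l : ℝ) :
    hsNormSq (windowField S l) = S.indicator (fun l => ENNReal.ofReal |l|) l := by
  rw [windowField, hsNormSq_rankOne, enorm_window_sq]
  by_cases h : l ∈ S
  · rw [indicator_of_mem h, indicator_of_mem h, enorm_window_sq,
      ← ENNReal.ofReal_mul (by positivity), abs_rpow_half_mul]
  · simp [h]

/-- The partial Fourier transform of the function with Plancherel transform `windowField S`. -/
noncomputable def windowSymbol (S : Set ℝ) (x : ℝ) (q : ℝ × ℝ) : ℂ :=
  S.indicator (fun l => ((|l| ^ (1 / 2 : ℝ) : ℝ) : ℂ)) q.2 *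
    ((Ioc (0 : ℝ) 1).indicator (fun _ => 1) (q.1 / q.2) *
      (Ioc (0 : ℝ) 1).indicator (fun _ => 1) (q.1 / q.2 - x))

theorem measurable_windowSymbol {S : Set ℝ} (hS : MeasurableSet S) :
    Measurable fun r : ℝ × (ℝ × ℝ) => windowSymbol S r.1 r.2 := by
  have h1 : Measurable (S.indicator fun l => ((|l| ^ (1 / 2 : ℝ) : ℝ) : ℂ)) :=
    Measurable.indicator (by fun_prop) hS
  have h2 : Measurable ((Ioc (0 : ℝ) 1).indicator fun _ => (1 : ℂ)) :=
    measurable_const.indicator measurableSet_Ioc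
  exact (h1.comp (f := fun r : ℝ × (ℝ × ℝ) => r.2.2) (by fun_prop)).mul
    ((h2.comp (f := fun r : ℝ × (ℝ × ℝ) => r.2.1 / r.2.2) (by fun_prop)).mul
      (h2.comp (f := fun r : ℝ × (ℝ × ℝ) => r.2.1 / r.2.2 - r.1) (by fun_prop)))

theorem norm_windowSymbol_le {S : Set ℝ} (hS : S ⊆ Icc (-1) 1) (x : ℝ) (q : ℝ × ℝ) :
    ‖windowSymbol S x q‖ ≤ 1 := by
  have h1 : ∀ r : ℝ, ‖(Ioc (0 : ℝ) 1).indicator (fun _ => (1 : ℂ)) r‖ ≤ 1 := fun r =>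
    (norm_indicator_le_norm_self _ _).trans (by simp)
  have h2 : ‖S.indicator (fun l => ((|l| ^ (1 / 2 : ℝ) : ℝ) : ℂ)) q.2‖ ≤ 1 := by
    by_cases h : q.2 ∈ S
    · rw [indicator_of_mem h, Complex.norm_real, Real.norm_of_nonneg (by positivity)]
      exact Real.rpow_le_one (abs_nonneg _) (abs_le.2 (hS h)) (by norm_num)
    · simp [h]
  rw [windowSymbol, norm_mul, norm_mul]
  exact mul_le_one₀ h2 (by positivity) (mul_le_one₀ (h1 _) (norm_nonneg _) (h1 _))

theorem support_windowSymbol {S : Set ℝ} (hS : S ⊆ Icc (-1) 1) (x : ℝ) (q : ℝ × ℝ)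
    (h : windowSymbol S x q ≠ 0) :
    x ∈ Icc (-1 : ℝ) 1 ∧ q ∈ Icc (-1 : ℝ) 1 ×ˢ Icc (-1 : ℝ) 1 := by
  have h1 : q.2 ∈ S := by
    by_contra h'
    exact h (by simp [windowSymbol, h'])
  have h2 : q.1 / q.2 ∈ Ioc (0 : ℝ) 1 := by
    by_contra h'
    exact h (by simp only [windowSymbol, indicator_of_notMem h', zero_mul, mul_zero])
  have h3 : q.1 / q.2 - x ∈ Ioc (0 : ℝ) 1 := by
    by_contra h'
    exact h (by simp only [windowSymbol, indicator_of_notMem h', mul_zero])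
  -- At `q.2 = 0` the quotient is `0` by convention, which the half-open interval excludes.
  have h4 : q.2 ≠ 0 := by
    rintro h'
    simp [h'] at h2
  refine ⟨⟨by linarith [h2.1, h3.2], by linarith [h2.2, h3.1]⟩, ?_, hS h1⟩
  have h5 : q.1 = q.1 / q.2 * q.2 := (div_mul_cancel₀ _ h4).symm
  rw [mem_Icc, ← abs_le, h5, abs_mul]
  exact mul_le_one₀ (abs_le.2 ⟨by linarith [h2.1], h2.2⟩) (abs_nonneg _) (abs_le.2 (hS h1))

/-- With `x = t - s` and `w = lt` one has `w / l = t` and `w / l - x = s`, so the symbol becomes the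
kernel `|l|^{1/2} 1(t) 1(s)` of the rank-one operator. -/
theorem hasKernel_windowField (S : Set ℝ) {l : ℝ} (hl : l ≠ 0) :
    HasKernel (windowField S l) fun t s => windowSymbol S (t - s) (l * t, l) := by
  intro φ
  by_cases h : l ∈ S
  · have e : windowField S l φ =
        (((|l| ^ (1 / 2 : ℝ) : ℝ) : ℂ) * ∫ t in Ioc (0 : ℝ) 1, φ t) • unitIndicator := by
      rw [windowField, indicator_of_mem h, InnerProductSpace.rankOne_apply, window,
        inner_smul_left, inner_unitIndicator, Complex.conj_ofReal, smul_smul,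
        mul_right_comm, ← Complex.ofReal_mul, abs_rpow_quarter_mul]
    rw [e]
    filter_upwards [Lp.coeFn_smul (((|l| ^ (1 / 2 : ℝ) : ℝ) : ℂ) *
      ∫ t in Ioc (0 : ℝ) 1, φ t) unitIndicator, coeFn_unitIndicator] with t h1 h2
    rw [h1, Pi.smul_apply, h2, ← integral_indicator measurableSet_Ioc, smul_eq_mul,
      ← integral_const_mul, ← integral_mul_const]
    refine integral_congr_ae (ae_of_all _ fun s => ?_)
    simp only [windowSymbol, indicator_of_mem h, mul_div_cancel_left₀ t hl, sub_sub_cancel]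
    by_cases hs : s ∈ Ioc (0 : ℝ) 1
    · simp only [indicator_of_mem hs]; ring
    · simp only [indicator_of_notMem hs]; ring
  · rw [windowField_of_notMem h, zero_apply]
    filter_upwards [Lp.coeFn_zero ℂ 2 (volume : Measure ℝ)] with t ht
    rw [ht]
    simp [windowSymbol, h]

theorem exists_isPlancherelTransform_windowField {S : Set ℝ} (hSm : NullMeasurableSet S volume)
    (hS : S ⊆ Icc (-1) 1) : ∃ f : L2H, IsPlancherelTransform f (windowField S) := by
  -- The symbol must be genuinely measurable, so `S` is replaced by a Borel subset of full measure;
  -- the fields agree almost everywhere.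
  obtain ⟨S₀, hS₀S, hS₀, hae⟩ := hSm.exists_measurable_subset_ae_eq
  refine exists_isPlancherelTransform (M := windowSymbol S₀) (measurable_windowSymbol hS₀)
    (norm_windowSymbol_le (hS₀S.trans hS)) (support_windowSymbol (hS₀S.trans hS)) ?_
  filter_upwards [hae.mem_iff, Measure.ae_ne volume (0 : ℝ)] with l h1 h2
  have e : windowField S l = windowField S₀ l := by
    by_cases h : l ∈ S
    · simp [windowField, h, h1.2 h]
    · simp [windowField, h, mt h1.1 h]
  rw [e]
  exact hasKernel_windowField S₀ h2

theorem norm_sq_le_of_windowField {S : Set ℝ} (hS : S ⊆ Icc (-1) 1) {f : L2H}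
    (hf : IsPlancherelTransform f (windowField S)) : ‖f‖ ^ 2 ≤ 2 / 3 := by
  have h := hf.lintegral_hsNormSq
  simp only [hsNormSq_windowField] at h
  rw [lintegral_plancherelMeasure] at h
  have h1 : ‖f‖ₑ ^ 2 ≤ ∫⁻ l in Icc (-1 : ℝ) 1, ENNReal.ofReal (l ^ 2) := by
    rw [← h, ← lintegral_indicator measurableSet_Icc]
    refine lintegral_mono fun l => ?_
    by_cases hl : l ∈ S
    · rw [indicator_of_mem hl, indicator_of_mem (hS hl), ← ofReal_norm, Real.norm_eq_abs,
        ← ENNReal.ofReal_mul (abs_nonneg _), abs_mul_abs_self, sq]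
    · simp [hl]
  rw [← ofReal_integral_eq_lintegral_ofReal, integral_Icc_eq_integral_Ioc,
    ← intervalIntegral.integral_of_le (by norm_num), integral_pow, ← ofReal_norm,
    ← ENNReal.ofReal_pow (norm_nonneg _), ENNReal.ofReal_le_ofReal_iff (by norm_num)] at h1
  · norm_num at h1
    linarith
  · exact (continuous_pow 2).integrableOn_Icc
  · exact ae_of_all _ fun l => sq_nonneg l

/-! ### The Parseval identity for the orbit -/

/-- The Gabor system `π_l(k₃, k₂, 0) |l|^{1/2} 1_{(0, 1]}`. -/
noncomputable def windowSystem (l : ℝ) (k : ℤ × ℤ) : L2R :=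
  schrodinger l (Heis.mk k.1 k.2 0) (((|l| ^ (1 / 2 : ℝ) : ℝ) : ℂ) • unitIndicator)

theorem windowSystem_eq_smul (l : ℝ) (k : ℤ × ℤ) :
    windowSystem l k =
      ((|l| ^ (1 / 4 : ℝ) : ℝ) : ℂ) • schrodinger l (Heis.mk k.1 k.2 0) (window l) := by
  rw [windowSystem, ← smul_window, ← schrodingerIsometry_apply, map_smul,
    schrodingerIsometry_apply]

theorem satisfiesParseval_windowSystem {l : ℝ} (hl : l ≠ 0) (hl1 : |l| ≤ 1) :
    SatisfiesParseval (windowSystem l) := by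
  intro φ
  rw [← satisfiesParseval_gaborSystem hl hl1 φ,
    ← ((Equiv.prodComm ℤ ℤ).trans ((Equiv.refl ℤ).prodCongr (Equiv.neg ℤ))).tsum_eq]
  refine tsum_congr fun mn => ?_
  rw [← Prod.mk.eta (p := mn), gaborSystem_eq_schrodinger]
  simp [windowSystem]

/-- Summing over `e` gives `‖A (e' k)‖²`; summing over `e'` then gives the Hilbert–Schmidt norm. -/
theorem SatisfiesParseval.tsum_inner_apply {ι κ : Type*} {e : ι → L2R} {e' : κ → L2R}
    (he : SatisfiesParseval e) (he' : SatisfiesParseval e') (A : L2R →L[ℂ] L2R) :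
    ∑' p : ι × κ, ‖⟪e p.1, A (e' p.2)⟫_ℂ‖ₑ ^ 2 = hsNormSq A := by
  rw [ENNReal.tsum_prod', ENNReal.tsum_comm, ← he'.tsum_enorm_apply_eq_hsNormSq A]
  refine tsum_congr fun k => ?_
  exact he (A (e' k))

theorem tsum_inner_apply_windowSystem {l : ℝ} (hl : l ≠ 0) (hl1 : |l| ≤ 1)
    (A : L2R →L[ℂ] L2R) :
    ∑' p : (ℤ × ℤ) × (ℤ × ℤ), ‖⟪windowSystem l p.1, A (windowSystem l p.2)⟫_ℂ‖ₑ ^ 2 =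
      hsNormSq A :=
  (satisfiesParseval_windowSystem hl hl1).tsum_inner_apply (satisfiesParseval_windowSystem hl hl1) A

/-- The centre acts by a character of `l`; this is the source of the Fourier series in `k₁`. -/
theorem schrodinger_central (l a b c : ℝ) (φ : L2R) :
    schrodinger l (Heis.mk a b c) φ =
      Complex.exp ((2 * Real.pi * c * l : ℝ) * Complex.I) • schrodinger l (Heis.mk a b 0) φ := by
  refine Lp.ext ?_
  filter_upwards [coeFn_phaseTranslate (fun t => 2 * Real.pi * l * (Heis.mk a b c).z -
      2 * Real.pi * l * (Heis.mk a b c).y * t) (by fun_prop) (Heis.mk a b c).x φ,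
    coeFn_phaseTranslate (fun t => 2 * Real.pi * l * (Heis.mk a b 0).z -
      2 * Real.pi * l * (Heis.mk a b 0).y * t) (by fun_prop) (Heis.mk a b 0).x φ,
    Lp.coeFn_smul (Complex.exp ((2 * Real.pi * c * l : ℝ) * Complex.I))
      (schrodinger l (Heis.mk a b 0) φ)] with t h1 h2 h3
  rw [h3, Pi.smul_apply, schrodinger, schrodinger, h1, h2, smul_eq_mul, ← mul_assoc,
    ← Complex.exp_add]
  simp only [Heis.x_mk, Heis.y_mk, Heis.z_mk]
  congr 2
  push_cast
  ring

/-- The element of `Λ` with the given integer coordinates. -/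
noncomputable def latticePoint (p : ((ℤ × ℤ) × (ℤ × ℤ)) × ℤ) : Heis × Heis :=
  (Heis.mk p.1.1.1 p.1.1.2 p.2, Heis.mk p.1.2.1 p.1.2.2 0)

/-- Integer coordinates on `Λ`. -/
noncomputable def latticeEquiv : ((ℤ × ℤ) × (ℤ × ℤ)) × ℤ ≃ Lam :=
  Equiv.ofBijective (fun p => ⟨latticePoint p, p.2, p.1.1.2, p.1.1.1, p.1.2.2, p.1.2.1, rfl⟩) <| by
    constructor
    · rintro ⟨⟨⟨a, b⟩, ⟨c, d⟩⟩, e⟩ ⟨⟨⟨a', b'⟩, ⟨c', d'⟩⟩, e'⟩ h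
      have h0 : latticePoint (((a, b), (c, d)), e) = latticePoint (((a', b'), (c', d')), e') :=
        congrArg Subtype.val h
      have h1 := congrArg Prod.fst h0
      have h2 := congrArg Prod.snd h0
      have e1 : (a : ℝ) = a' := congrArg Heis.x h1
      have e2 : (b : ℝ) = b' := congrArg Heis.y h1
      have e3 : (e : ℝ) = e' := congrArg Heis.z h1
      have e4 : (c : ℝ) = c' := congrArg Heis.x h2
      have e5 : (d : ℝ) = d' := congrArg Heis.y h2
      norm_cast at e1 e2 e3 e4 e5
      subst e1 e2 e3 e4 e5
      rfl
    · rintro ⟨w, k₁, k₂, k₃, m₂, m₃, rfl⟩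
      exact ⟨(((k₃, k₂), (m₃, m₂)), k₁), rfl⟩

/-- The function on the line whose Fourier coefficients are the inner products of a function with
Plancherel transform `H` with the elements of the orbit. -/
noncomputable def coefficientDensity (S : Set ℝ) (H : ℝ → L2R →L[ℂ] L2R)
    (p : (ℤ × ℤ) × (ℤ × ℤ)) : ℝ → ℂ :=
  S.indicator fun l => ((|l| ^ (1 / 2 : ℝ) : ℝ) : ℂ) *
    ⟪windowSystem l p.1, H l (windowSystem l p.2)⟫_ℂ

theorem aemeasurable_inner_windowSystem {H : ℝ → L2R →L[ℂ] L2R}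
    (hH : ∀ φ ψ : L2R, AEMeasurable (fun l => ⟪ψ, H l φ⟫_ℂ) volume)
    (p : (ℤ × ℤ) × (ℤ × ℤ)) :
    AEMeasurable (fun l => ⟪windowSystem l p.1, H l (windowSystem l p.2)⟫_ℂ) volume := by
  have h : ∀ (k : ℤ × ℤ) (ψ : L2R), AEMeasurable (fun l => ⟪ψ, windowSystem l k⟫_ℂ) volume := by
    intro k ψ
    have e : (fun l => ⟪ψ, windowSystem l k⟫_ℂ) = fun l => ((|l| ^ (1 / 2 : ℝ) : ℝ) : ℂ) *
        ⟪ψ, schrodinger l (Heis.mk k.1 k.2 0) unitIndicator⟫_ℂ := by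
      funext l
      rw [windowSystem, ← schrodingerIsometry_apply, map_smul, inner_smul_right,
        schrodingerIsometry_apply]
    rw [e]
    exact ((by fun_prop : Measurable fun l : ℝ => ((|l| ^ (1 / 2 : ℝ) : ℝ) : ℂ)).mul
      (measurable_inner_schrodinger _ _ _)).aemeasurable
  exact aemeasurable_inner_apply hH (h p.2) (h p.1)

theorem aemeasurable_coefficientDensity {S : Set ℝ} (hS : MeasurableSet S)
    {H : ℝ → L2R →L[ℂ] L2R} (hH : ∀ φ ψ : L2R, AEMeasurable (fun l => ⟪ψ, H l φ⟫_ℂ) volume)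
    (p : (ℤ × ℤ) × (ℤ × ℤ)) : AEMeasurable (coefficientDensity S H p) volume :=
  AEMeasurable.indicator ((by fun_prop : Measurable fun l : ℝ =>
    ((|l| ^ (1 / 2 : ℝ) : ℝ) : ℂ)).aemeasurable.mul (aemeasurable_inner_windowSystem hH p)) hS

theorem enorm_coefficientDensity_sq (S : Set ℝ) (H : ℝ → L2R →L[ℂ] L2R)
    (p : (ℤ × ℤ) × (ℤ × ℤ)) (l : ℝ) :
    ‖coefficientDensity S H p l‖ₑ ^ 2 = S.indicator (fun l => ‖l‖ₑ *
      ‖⟪windowSystem l p.1, H l (windowSystem l p.2)⟫_ℂ‖ₑ ^ 2) l := by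
  by_cases h : l ∈ S
  · rw [coefficientDensity, indicator_of_mem h, indicator_of_mem h, enorm_mul, mul_pow]
    congr 1
    rw [← ofReal_norm, Complex.norm_real, Real.norm_of_nonneg (by positivity),
      ← ENNReal.ofReal_pow (by positivity), sq, abs_rpow_half_mul, ← ofReal_norm,
      Real.norm_eq_abs]
  · simp [coefficientDensity, h]

/-- The double Parseval identity of the Gabor system is applied at each `l` in `S`; the squared
weight `|l|` is the Plancherel density. -/
theorem tsum_lintegral_coefficientDensity {S : Set ℝ} (hSm : MeasurableSet S)
    (hS : S ⊆ Icc (-1) 1) {H : ℝ → L2R →L[ℂ] L2R} (hH : IsL2Field H)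
    (hHS : ∀ᵐ l, l ∉ S → H l = 0) :
    ∑' p, ∫⁻ l, ‖coefficientDensity S H p l‖ₑ ^ 2 =
      ∫⁻ l, hsNormSq (H l) ∂plancherelMeasure := by
  rw [← lintegral_tsum fun p =>
    ((aemeasurable_coefficientDensity hSm hH.1 p).enorm.pow_const 2), lintegral_plancherelMeasure]
  refine lintegral_congr_ae ?_
  filter_upwards [hHS, Measure.ae_ne volume (0 : ℝ)] with l h1 h2
  simp only [enorm_coefficientDensity_sq]
  by_cases h : l ∈ S
  · simp only [indicator_of_mem h]
    rw [ENNReal.tsum_mul_left, tsum_inner_apply_windowSystem h2 (abs_le.2 (hS h))]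
  · simp only [indicator_of_notMem h, tsum_zero]
    rw [h1 h, hsNormSq_zero, mul_zero]

theorem inner_tau_eq_integral {S S₀ : Set ℝ} (hae : S₀ =ᵐ[volume] S) {f h : L2H}
    (hf : IsPlancherelTransform f (windowField S)) {H : ℝ → L2R →L[ℂ] L2R}
    (hh : IsPlancherelTransform h H) (p : ((ℤ × ℤ) × (ℤ × ℤ)) × ℤ) :
    ⟪tau (latticePoint p) f, h⟫_ℂ = ∫ l, Complex.exp ((-(2 * Real.pi * p.2 * l) : ℝ) * Complex.I) *
      coefficientDensity S₀ H p.1 l := by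
  have h1 := hf.tau (latticePoint p)
  simp only [windowField, conjOp_rankOne] at h1
  have h2 := integral_withDensity_eq_integral_smul (μ := (volume : Measure ℝ))
    (f := fun l : ℝ => ‖l‖₊) (by fun_prop) (fun l => ⟪schrodinger l (latticePoint p).1
      (S.indicator window l), H l (schrodinger l (latticePoint p).2 (window l))⟫_ℂ)
  rw [h1.inner_eq_integral hh, plancherelMeasure]
  refine h2.trans (integral_congr_ae ?_)
  filter_upwards [hae.mem_iff] with l hl
  by_cases hS : l ∈ S
  · rw [coefficientDensity, indicator_of_mem hS, indicator_of_mem (hl.2 hS),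
      windowSystem_eq_smul, windowSystem_eq_smul, map_smul, inner_smul_left, inner_smul_right]
    simp only [latticePoint]
    rw [schrodinger_central l _ _ (p.2 : ℝ), inner_smul_left, ← Complex.exp_conj, map_mul,
      Complex.conj_I, Complex.conj_ofReal, Complex.conj_ofReal, NNReal.smul_def, coe_nnnorm,
      Real.norm_eq_abs, Complex.real_smul]
    -- The density `|l|` is shared out: `|l|^{1/4}` goes to each of the two windows, making their
    -- systems Parseval, and `|l|^{1/2}` stays in `coefficientDensity`.
    have e : ((|l| : ℝ) : ℂ) = ((|l| ^ (1 / 2 : ℝ) : ℝ) : ℂ) * (((|l| ^ (1 / 4 : ℝ) : ℝ) : ℂ) *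
        ((|l| ^ (1 / 4 : ℝ) : ℝ) : ℂ)) := by
      rw [← Complex.ofReal_mul, ← Complex.ofReal_mul, abs_rpow_quarter_mul, abs_rpow_half_mul]
    rw [e]
    simp only [Complex.ofReal_neg, neg_mul, mul_neg]
    ring
  · rw [coefficientDensity, indicator_of_notMem hS, indicator_of_notMem (mt hl.1 hS),
      ← schrodingerIsometry_apply, map_zero, inner_zero_left, smul_zero, mul_zero]

theorem tsum_inner_tau {S : Set ℝ} (hSm : NullMeasurableSet S volume) (hS : S ⊆ Icc (-1) 1)
    (hcong : TranslationCongruent S (Ioc 0 1)) {f h : L2H}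
    (hf : IsPlancherelTransform f (windowField S)) {H : ℝ → L2R →L[ℂ] L2R}
    (hh : IsPlancherelTransform h H) (hHS : ∀ᵐ l, l ∉ S → H l = 0) :
    ∑' w : Lam, ‖⟪tau w f, h⟫_ℂ‖ₑ ^ 2 = ‖h‖ₑ ^ 2 := by
  obtain ⟨S₁, hS₁S, hS₁, hae₁⟩ := hSm.exists_measurable_subset_ae_eq
  -- Dropping the point `-1` places the set in the union of the fundamental domains `(-1, 0]` and
  -- `(0, 1]`.
  set S₀ := S₁ ∩ Ioc (-1 : ℝ) 1 with hS₀
  have hS₀m : MeasurableSet S₀ := hS₁.inter measurableSet_Ioc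
  have hS₀S : S₀ ⊆ S := inter_subset_left.trans hS₁S
  have hae : S₀ =ᵐ[volume] S := by
    refine eventuallyEq_set.2 ?_
    filter_upwards [hae₁.mem_iff, Measure.ae_ne volume (-1 : ℝ)] with l h1 h2
    refine ⟨fun h => hS₀S h, fun h => ⟨h1.2 h, lt_of_le_of_ne (hS h).1 h2.symm, (hS h).2⟩⟩
  have hHS₀ : ∀ᵐ l, l ∉ S₀ → H l = 0 := by
    filter_upwards [hae.mem_iff, hHS] with l h1 h2 h3 using h2 (mt h1.2 h3)
  have hsum := tsum_lintegral_coefficientDensity hS₀m (hS₀S.trans hS) hh.1 hHS₀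
  -- The inner sum is over the central coordinate, with the four Gabor indices fixed.
  rw [← hh.lintegral_hsNormSq, ← hsum, ← latticeEquiv.tsum_eq, ENNReal.tsum_prod']
  refine tsum_congr fun p => ?_
  -- One term of a series with finite sum `‖h‖²` is finite.
  have hL2 : MemLp (coefficientDensity S₀ H p) 2 volume := by
    refine (memLp_two_iff_lintegral
      (aemeasurable_coefficientDensity hS₀m hh.1.1 p).aestronglyMeasurable).2 ?_
    refine (ENNReal.le_tsum (f := fun p => ∫⁻ l, ‖coefficientDensity S₀ H p l‖ₑ ^ 2) p).trans_lt ?_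
    rw [hsum]
    exact hh.1.2
  rw [← tsum_enorm_fourier_integral_of_disjoint hL2]
  · refine tsum_congr fun k => ?_
    rw [← inner_tau_eq_integral hae hf hh (p, k)]
    rfl
  · intro l hl
    exact indicator_of_notMem (fun h => hl h.2) _
  · filter_upwards [hcong.ae_not_mem] with r hr hr1
    by_contra! hne
    refine hr hr1 ⟨hS₀S ?_, hS₀S ?_⟩
    · by_contra h'
      exact hne.1 (indicator_of_notMem h' _)
    · by_contra h'
      exact hne.2 (indicator_of_notMem h' _)

end HeisenbergFrames

open HeisenbergFrames
theorem theorem1p1 (S : Set ℝ) (hSmeas : NullMeasurableSet S volume) (hS : S ⊆ Icc (-1) 1)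
    (hcong : TranslationCongruent S (Ioc 0 1)) :
    ∃ f ∈ bandlimited S,
      IsParsevalFrame (bandlimited S) (fun w : Lam => tau w f) ∧
      ‖f‖ ^ 2 ≤ 2 / 3 ∧
      ∃ u v : ℝ → L2R,
        IsPlancherelTransform f
          (S.indicator fun l => InnerProductSpace.rankOne ℂ (u l) (v l)) ∧
        ∀ l ∈ S, l ≠ 0 →
          IsParsevalFrame ⊤ (gaborSystem 1 l (((|l| ^ (1 / 4 : ℝ) : ℝ) : ℂ) • u l)) ∧
          IsParsevalFrame ⊤ (gaborSystem 1 l (((|l| ^ (1 / 4 : ℝ) : ℝ) : ℂ) • star (v l))) := by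
  obtain ⟨f, hf⟩ := exists_isPlancherelTransform_windowField hSmeas hS
  have hzero : ∀ l, l ∉ S → windowField S l = 0 := fun l hl => windowField_of_notMem hl
  refine ⟨f, ⟨_, hf, ae_of_all _ hzero⟩, ⟨fun w => ⟨_, hf.tau w, ae_of_all _ fun l hl => ?_⟩, ?_⟩,
    norm_sq_le_of_windowField hS hf, window, window, ?_, fun l hl hl0 => ?_⟩
  · rw [hzero l hl]
    simp [conjOp]
  · rintro h ⟨H, hh, hHS⟩
    exact hasSum_of_tsum_enorm_sq_eq (tsum_inner_tau hSmeas hS hcong hf hh hHS)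
  · rwa [← windowField_eq_indicator]
  · have h := (satisfiesParseval_gaborSystem hl0 (abs_le.2 (hS hl))).isParsevalFrame
    -- The window is real, so both Gabor windows are `|l|^{1/2} 1_{(0,1]}`.
    rw [star_window, smul_window]
    exact ⟨h, h⟩
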